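/- Let $k$ be an algebraically closed field of arbitrary characteristic, $R=k[x_0,x_1,x_2]$, and let $C\subset\mathbb P^2_k$ be an irreducible cubic curve, defined by an irreducible form $F\in R$ of degree $3$, which is singular at the point $P$ (that is, $F$ and its first partial derivatives vanish at $P$). For a finite set $X$ of (distinct) points of $\mathbb P^2_k$ let $2X$ be the double point scheme defined by the ideal $\bigcap_{p\in X}I(p)^2$, where $I(p)\subset R$ is the homogeneous ideal of $p$; let $h_{2X}(d)=\dim_k\big(R/\bigcap_{p\in X}I(p)^2\big)_d$ be its Hilbert function and $\Delta h_{2X}(d)=h_{2X}(d)-h_{2X}(d-1)$, with $h_{2X}(-1)=0$, its first difference. Let $t>3$ be an integer. If $X\subset C$ is a set of $3t+\delta$ points with $P\in X$ and $0\le\delta\le 2$, then $\Delta h_{2X}(d)=d+1$ for $0\le d\le 4$, and the remaining values are as follows. 1. If $\delta=0$: $\Delta h_{2X}(d)=6$ for $5\le d\le t+2$, $\Delta h_{2X}(t+3)=5$, $\Delta h_{2X}(d)=3$ for $t+4\le d\le 2t$, $\Delta h_{2X}(2t+1)=1$, and $\Delta h_{2X}(d)=0$ for $d\ge 2t+2$.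 2. If $\delta=1$: either (a) $\Delta h_{2X}(d)=6$ for $5\le d\le t+3$, $\Delta h_{2X}(d)=3$ for $t+4\le d\le 2t+1$, and $\Delta h_{2X}(d)=0$ for $d\ge 2t+2$; or (b) $\Delta h_{2X}(d)=6$ for $5\le d\le t+2$, $\Delta h_{2X}(t+3)=5$, $\Delta h_{2X}(t+4)=4$, $\Delta h_{2X}(d)=3$ for $t+5\le d\le 2t+1$, and $\Delta h_{2X}(d)=0$ for $d\ge 2t+2$. 3. If $\delta=2$: $\Delta h_{2X}(d)=6$ for $5\le d\le t+3$, $\Delta h_{2X}(t+4)=4$, $\Delta h_{2X}(d)=3$ for $t+5\le d\le 2t+1$, $\Delta h_{2X}(2t+2)=2$, and $\Delta h_{2X}(d)=0$ for $d\ge 2t+3$. Moreover, both possibilities in case 2 occur: for every such $C$, $P$ and $t>3$ there is a set $X\subset C$ of $3t+1$ points with $P\in X$ for which (a) holds, and there is one for which (b) holds. -/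

import Mathlib

open scoped LinearAlgebra.Projectivization

namespace FatPoints

noncomputable section

/-- The projective plane over `k`, as the set of lines through the origin of `k ^ 3`. -/
abbrev Plane (k : Type*) [Field k] : Type _ := ℙ k (Fin 3 → k)

variable {k : Type*} [Field k]

/-- The form `F` vanishes at the point `p`. (For homogeneous `F` this does not depend on the
representative of `p`; it is only used for homogeneous `F`.) -/
def VanishesAt (F : MvPolynomial (Fin 3) k) (p : Plane k) : Prop :=
  MvPolynomial.eval p.rep F = 0

/-- `p` is a singular point of the plane curve `F = 0`: the form `F` and all its first partial
derivatives vanish at `p`. -/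
def IsSingularPoint (F : MvPolynomial (Fin 3) k) (p : Plane k) : Prop :=
  VanishesAt F p ∧ ∀ i : Fin 3, VanishesAt (MvPolynomial.pderiv i F) p

/-- The homogeneous ideal `I(p)` of a point `p`, generated by all forms vanishing at `p`. -/
def pointIdeal (p : Plane k) : Ideal (MvPolynomial (Fin 3) k) :=
  Ideal.span {G | ∃ d : ℕ, G.IsHomogeneous d ∧ VanishesAt G p}

/-- The homogeneous ideal `⋂_{p ∈ X} I(p) ^ m` of the fat point scheme `mX`. -/
def fatIdeal (m : ℕ) (X : Finset (Plane k)) : Ideal (MvPolynomial (Fin 3) k) :=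
  ⨅ p ∈ X, pointIdeal p ^ m

/-- The Hilbert function `d ↦ dim_k (R / I)_d = dim_k (R_d / (I ∩ R_d))` of a homogeneous ideal
`I` of `R = k[x₀, x₁, x₂]`. -/
def hilbertFn (I : Ideal (MvPolynomial (Fin 3) k)) (d : ℕ) : ℕ :=
  Module.finrank k
    (MvPolynomial.homogeneousSubmodule (Fin 3) k d ⧸
      (I.restrictScalars k).comap (MvPolynomial.homogeneousSubmodule (Fin 3) k d).subtype)

/-- The first difference `Δh(d) = h(d) - h(d - 1)` of a function `h`, with `h(-1) = 0`. -/
def firstDiff (h : ℕ → ℕ) : ℕ → ℤ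
  | 0 => h 0
  | d + 1 => (h (d + 1) : ℤ) - h d

/-- The difference function `Δh_{2X}` of the double point scheme `2X`. -/
def doubleDiff (X : Finset (Plane k)) : ℕ → ℤ :=
  firstDiff (hilbertFn (fatIdeal 2 X))

/-- `1 2 3 4 5`, then `6` in degrees `5, …, t+2`, `5` in degree `t+3`, `3` in degrees
`t+4, …, 2t`, `1` in degree `2t+1`, and `0` from degree `2t+2` on. -/
def table0 (t d : ℕ) : ℤ :=
  if d ≤ 4 then d + 1
  else if d ≤ t + 2 then 6
  else if d = t + 3 then 5
  else if d ≤ 2 * t then 3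
  else if d = 2 * t + 1 then 1
  else 0

/-- `1 2 3 4 5`, then `6` in degrees `5, …, t+3`, `3` in degrees `t+4, …, 2t+1`, and `0` from
degree `2t+2` on. -/
def table1a (t d : ℕ) : ℤ :=
  if d ≤ 4 then d + 1
  else if d ≤ t + 3 then 6
  else if d ≤ 2 * t + 1 then 3
  else 0

/-- `1 2 3 4 5`, then `6` in degrees `5, …, t+2`, `5` in degree `t+3`, `4` in degree `t+4`, `3` in
degrees `t+5, …, 2t+1`, and `0` from degree `2t+2` on. -/
def table1b (t d : ℕ) : ℤ :=
  if d ≤ 4 then d + 1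
  else if d ≤ t + 2 then 6
  else if d = t + 3 then 5
  else if d = t + 4 then 4
  else if d ≤ 2 * t + 1 then 3
  else 0

/-- `1 2 3 4 5`, then `6` in degrees `5, …, t+3`, `4` in degree `t+4`, `3` in degrees
`t+5, …, 2t+1`, `2` in degree `2t+2`, and `0` from degree `2t+3` on. -/
def table2 (t d : ℕ) : ℤ :=
  if d ≤ 4 then d + 1
  else if d ≤ t + 3 then 6
  else if d = t + 4 then 4
  else if d ≤ 2 * t + 1 then 3
  else if d = 2 * t + 2 then 2
  else 0

end

end FatPoints

/-!
Choose coordinates in which the singular point is `P = (1 : 0 : 0)` and the cubic `C` is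
`x₀ q(x₁, x₂) + c(x₁, x₂) = 0`, where the tangent cone `q` vanishes at `(1 : 0)`. The smooth points
of `C` are then parametrized by the `u = x₁ / x₂` with `q u ≠ 0`, via `u ↦ (-c u : u q u : q u)`,
and forms of degree `d` pull back to binary forms of degree `3 d`. The image of this pullback has
codimension one for `d ≥ 1`, reflecting the one gluing condition at the singular point, and its
kernel consists of the multiples of `F`.

Let `X = U ∪ {P}` with `U` a set of smooth points. The forms of degree `d + 3` that are double along
`X` pull back onto the binary forms of degree `3 (d + 3)` divisible by `S² q²`, where
`S = ∏ (u - uᵢ)`. If the pullback vanishes, the form is `F A`, and then `A` only has to vanish on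
`U`, because `F` is already double at `P`. Hence `h_{2X}(d + 3)` is the sum of
`min (3 (d + 3)) (2 |U| + 3)` and `h_U(d)`.

Finally `h_U(d) = min (3 d) |U|` for `d ≥ 1`, except possibly when `3 d = |U|`: there the value is
`|U| - 1` if a form of degree `d` cuts out `U` on `C`, and `|U|` otherwise. This ambiguity arises
only for `|X| = 3 t + 1`, where `|U| = 3 t`. In that case the form exists exactly when the points of
`U` have a prescribed product in the group of smooth points of `C`, which is `kˣ` or the additive
group of `k`; so both possibilities occur.
-/

namespace FatPoints

open MvPolynomial
open scoped Pointwise Polynomial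

/-! ### Forms singular at a point -/

section DoublePoints

variable {σ k : Type*} [Field k]

theorem aeval_mul_of_isHomogeneous {A : Type*} [CommRing A] [Algebra k A] {d : ℕ}
    {G : MvPolynomial σ k} (hG : G.IsHomogeneous d) (s : A) (x : σ → A) :
    aeval (fun i => s * x i) G = s ^ d * aeval x G := by
  simp only [aeval_def, eval₂_eq, Finset.mul_sum]
  refine Finset.sum_congr rfl fun m hm => ?_
  simp only [mul_pow, Finset.prod_mul_distrib, Finset.prod_pow_eq_pow_sum]
  rw [← hG.degree_eq_sum_deg_support hm]
  ring

theorem eval_smul_of_isHomogeneous {d : ℕ} {G : MvPolynomial σ k} (hG : G.IsHomogeneous d)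
    (a : k) (v : σ → k) : eval (a • v) G = a ^ d * eval v G :=
  aeval_mul_of_isHomogeneous hG a v

theorem eval_smul_eq_zero_iff {d : ℕ} {G : MvPolynomial σ k} (hG : G.IsHomogeneous d)
    {a : k} (ha : a ≠ 0) (v : σ → k) : eval (a • v) G = 0 ↔ eval v G = 0 := by
  rw [eval_smul_of_isHomogeneous hG, mul_eq_zero, or_iff_right (pow_ne_zero d ha)]

/-- The hypersurface `G = 0` in affine space is singular at the vector `v`. -/
def DoubleAt (v : σ → k) (G : MvPolynomial σ k) : Prop :=
  eval v G = 0 ∧ ∀ i, eval v (pderiv i G) = 0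

theorem DoubleAt.add {v : σ → k} {G H : MvPolynomial σ k} (hG : DoubleAt v G)
    (hH : DoubleAt v H) : DoubleAt v (G + H) :=
  ⟨by rw [map_add, hG.1, hH.1, add_zero], fun i => by rw [map_add, map_add, hG.2, hH.2, add_zero]⟩

theorem DoubleAt.mul_left {v : σ → k} {G : MvPolynomial σ k} (hG : DoubleAt v G)
    (H : MvPolynomial σ k) : DoubleAt v (H * G) :=
  ⟨by rw [map_mul, hG.1, mul_zero], fun i => by
    rw [Derivation.leibniz, map_add, smul_eq_mul, smul_eq_mul, map_mul, map_mul, hG.1, hG.2,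
      mul_zero, zero_mul, add_zero]⟩

theorem DoubleAt.sum {ι : Type*} {v : σ → k} {s : Finset ι} {G : ι → MvPolynomial σ k}
    (hG : ∀ j ∈ s, DoubleAt v (G j)) : DoubleAt v (∑ j ∈ s, G j) :=
  Finset.sum_induction _ _ (fun _ _ => DoubleAt.add)
    ⟨map_zero _, fun _ => by rw [map_zero, map_zero]⟩ hG

theorem doubleAt_add_iff {v : σ → k} {G H : MvPolynomial σ k} (hG : DoubleAt v G) :
    DoubleAt v (G + H) ↔ DoubleAt v H := by
  simp only [DoubleAt, map_add, hG.1, hG.2, zero_add]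

theorem doubleAt_mul {v : σ → k} {G H : MvPolynomial σ k} (hG : eval v G = 0)
    (hH : eval v H = 0) : DoubleAt v (G * H) :=
  ⟨by rw [map_mul, hG, zero_mul], fun i => by
    rw [Derivation.leibniz, map_add, smul_eq_mul, smul_eq_mul, map_mul, map_mul, hG, hH,
      zero_mul, zero_mul, add_zero]⟩

theorem doubleAt_smul_iff {d : ℕ} {G : MvPolynomial σ k} (hG : G.IsHomogeneous d)
    {a : k} (ha : a ≠ 0) (v : σ → k) : DoubleAt (a • v) G ↔ DoubleAt v G := by
  simp only [DoubleAt, eval_smul_eq_zero_iff hG ha,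
    fun i => eval_smul_eq_zero_iff (hG.pderiv (i := i)) ha v]

theorem sum_aeval_pderiv_mul_X [Fintype σ] {A : Type*} [CommRing A] [Algebra k A] (a m : σ → A)
    (G : MvPolynomial σ k) (n : σ) : ∑ i, aeval a (pderiv i (G * X n)) * m i =
      a n * ∑ i, aeval a (pderiv i G) * m i + aeval a G * m n := by
  classical
  simp only [Derivation.leibniz, pderiv_X, smul_eq_mul, map_add, map_mul, aeval_X, add_mul,
    Finset.sum_add_distrib, Finset.mul_sum, Pi.single_apply, apply_ite (aeval a), map_zero,
    mul_ite, ite_mul, mul_one, mul_zero, zero_mul, Finset.sum_ite_eq, Finset.mem_univ, if_true]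
  rw [add_comm]
  simp only [mul_assoc]

theorem derivative_aeval [Fintype σ] (f : σ → k[X]) (G : MvPolynomial σ k) :
    (aeval f G).derivative = ∑ i, aeval f (pderiv i G) * (f i).derivative := by
  induction G using MvPolynomial.induction_on with
  | C a => simp
  | add p r hp hr => simp only [map_add, hp, hr, add_mul, Finset.sum_add_distrib]
  | mul_X p n hp =>
    rw [sum_aeval_pderiv_mul_X, ← hp, map_mul, aeval_X, Polynomial.derivative_mul]
    ring

theorem aeval_add_sub_mem_sq [Fintype σ] {A : Type*} [CommRing A] [Algebra k A] {I : Ideal A}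
    (a m : σ → A) (hm : ∀ i, m i ∈ I) (G : MvPolynomial σ k) :
    aeval (a + m) G - (aeval a G + ∑ i, aeval a (pderiv i G) * m i) ∈ I ^ 2 := by
  induction G using MvPolynomial.induction_on with
  | C c => simp
  | add p q hp hq =>
    convert add_mem hp hq using 1
    simp only [map_add, add_mul, Finset.sum_add_distrib]
    ring
  | mul_X p n hp =>
    have hlin : (∑ i, aeval a (pderiv i p) * m i) * m n ∈ I ^ 2 := by
      rw [pow_two]
      exact Ideal.mul_mem_mul (sum_mem fun i _ => Ideal.mul_mem_left _ _ (hm i)) (hm n)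
    convert add_mem (Ideal.mul_mem_right (a n + m n) _ hp) hlin using 1
    rw [sum_aeval_pderiv_mul_X]
    simp only [map_mul, aeval_X, Pi.add_apply]
    ring

end DoublePoints

section PointIdeal

variable {k : Type*} [Field k]

theorem vanishesAt_mk {d : ℕ} {G : MvPolynomial (Fin 3) k} (hG : G.IsHomogeneous d)
    {v : Fin 3 → k} (hv : v ≠ 0) :
    VanishesAt G (Projectivization.mk k v hv) ↔ eval v G = 0 := by
  obtain ⟨a, ha⟩ := Projectivization.exists_smul_eq_mk_rep k v hv
  rw [VanishesAt, ← ha]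
  exact eval_smul_eq_zero_iff hG a.ne_zero v

theorem eval_rep_of_mem_pointIdeal {p : Plane k} {G : MvPolynomial (Fin 3) k}
    (hG : G ∈ pointIdeal p) : eval p.rep G = 0 := by
  have hle : pointIdeal p ≤ RingHom.ker (eval p.rep) :=
    Ideal.span_le.2 fun _ ⟨_, _, hH⟩ => hH
  exact hle hG

theorem doubleAt_rep_of_mem_sq {p : Plane k} {G : MvPolynomial (Fin 3) k}
    (hG : G ∈ pointIdeal p ^ 2) : DoubleAt p.rep G := by
  rw [pow_two] at hG
  induction hG using Submodule.mul_induction_on' with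
  | mem_mul_mem a ha b hb =>
    exact doubleAt_mul (eval_rep_of_mem_pointIdeal ha) (eval_rep_of_mem_pointIdeal hb)
  | add a _ b _ ha hb => exact ha.add hb

theorem cross_mem_pointIdeal (p : Plane k) (i j : Fin 3) :
    C (p.rep j) * X i - X j * C (p.rep i) ∈ pointIdeal p := by
  refine Ideal.subset_span ⟨1, (isHomogeneous_C_mul_X _ _).sub ?_, ?_⟩
  · rw [mul_comm]
    exact isHomogeneous_C_mul_X _ _
  · simp only [VanishesAt, map_sub, map_mul, eval_C, eval_X]
    ring

theorem mem_pointIdeal_sq_iff {d : ℕ} {G : MvPolynomial (Fin 3) k} (hG : G.IsHomogeneous d)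
    (p : Plane k) : G ∈ pointIdeal p ^ 2 ↔ DoubleAt p.rep G := by
  refine ⟨doubleAt_rep_of_mem_sq, fun h => ?_⟩
  obtain ⟨j, hj : p.rep j ≠ 0⟩ := Function.ne_iff.1 p.rep_nonzero
  -- Expand `G (p_j x) = p_j ^ d * G x` to first order around `x_j p`, with increments in `I(p)`.
  have htaylor := aeval_add_sub_mem_sq (fun i => X j * C (p.rep i))
    (fun i => C (p.rep j) * X i - X j * C (p.rep i)) (fun i => cross_mem_pointIdeal p i j) G
  have hzero {n : ℕ} {H : MvPolynomial (Fin 3) k} (hH : H.IsHomogeneous n)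
      (h0 : eval p.rep H = 0) :
      aeval (fun i => X j * C (p.rep i) : Fin 3 → MvPolynomial (Fin 3) k) H = 0 := by
    have hC : aeval (fun i => C (p.rep i) : Fin 3 → MvPolynomial (Fin 3) k) H =
        C (eval p.rep H) := by
      rw [← aeval_eq_eval, ← algebraMap_eq, ← aeval_algebraMap_apply]
      rfl
    rw [aeval_mul_of_isHomogeneous hH, hC, h0, map_zero, mul_zero]
  have hsum : (fun i => X j * C (p.rep i)) + (fun i => C (p.rep j) * X i - X j * C (p.rep i)) =
      fun i => C (p.rep j) * (X i : MvPolynomial (Fin 3) k) :=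
    funext fun i => add_sub_cancel _ _
  rw [hsum, aeval_mul_of_isHomogeneous hG, aeval_X_left_apply, hzero hG h.1,
    Finset.sum_eq_zero fun i _ => by rw [hzero hG.pderiv (h.2 i), zero_mul], add_zero,
    sub_zero] at htaylor
  exact (Ideal.unit_mul_mem_iff_mem _ (((isUnit_iff_ne_zero.2 hj).map C).pow d)).1 htaylor

theorem mem_pointIdeal_mk_sq_iff {d : ℕ} {G : MvPolynomial (Fin 3) k} (hG : G.IsHomogeneous d)
    {v : Fin 3 → k} (hv : v ≠ 0) :
    G ∈ pointIdeal (Projectivization.mk k v hv) ^ 2 ↔ DoubleAt v G := by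
  obtain ⟨a, ha⟩ := Projectivization.exists_smul_eq_mk_rep k v hv
  rw [mem_pointIdeal_sq_iff hG, ← ha]
  exact doubleAt_smul_iff hG a.ne_zero v

theorem mem_fatIdeal {m : ℕ} {X : Finset (Plane k)} {G : MvPolynomial (Fin 3) k} :
    G ∈ fatIdeal m X ↔ ∀ p ∈ X, G ∈ pointIdeal p ^ m := by
  simp only [fatIdeal, Submodule.mem_iInf]

end PointIdeal

/-! ### Linear changes of coordinates -/

section LinearChange

variable {σ k : Type*} [Fintype σ] [DecidableEq σ] [Field k]

theorem bind₁_toMvPolynomial_symm (e : (σ → k) ≃ₗ[k] (σ → k)) :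
    (bind₁ (LinearMap.toMatrix' e.symm.toLinearMap).toMvPolynomial).comp
      (bind₁ (LinearMap.toMatrix' e.toLinearMap).toMvPolynomial) =
        AlgHom.id k (MvPolynomial σ k) := by
  refine algHom_ext fun i => ?_
  rw [AlgHom.comp_apply, bind₁_X_right, ← Matrix.toMvPolynomial_mul, ← LinearMap.toMatrix'_comp,
    LinearEquiv.comp_coe, LinearEquiv.symm_trans_self, LinearEquiv.refl_toLinearMap,
    LinearMap.toMatrix'_id, Matrix.toMvPolynomial_one, AlgHom.id_apply]

/-- The linear change of coordinates `G ↦ G ∘ e`. -/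
noncomputable def linSubst (e : (σ → k) ≃ₗ[k] (σ → k)) :
    MvPolynomial σ k ≃ₐ[k] MvPolynomial σ k :=
  AlgEquiv.ofAlgHom (bind₁ (LinearMap.toMatrix' e.toLinearMap).toMvPolynomial)
    (bind₁ (LinearMap.toMatrix' e.symm.toLinearMap).toMvPolynomial)
    (bind₁_toMvPolynomial_symm e.symm) (bind₁_toMvPolynomial_symm e)

theorem eval_linSubst (e : (σ → k) ≃ₗ[k] (σ → k)) (v : σ → k) (G : MvPolynomial σ k) :
    eval v (linSubst e G) = eval (e v) G := by
  have h := DFunLike.congr_fun (aeval_comp_bind₁ (fun i => (v i : k))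
    (LinearMap.toMatrix' e.toLinearMap).toMvPolynomial) G
  simp only [AlgHom.comp_apply, aeval_eq_eval] at h
  refine h.trans ?_
  congr! 2
  funext i
  rw [Matrix.toMvPolynomial_eval_eq_apply, ← Matrix.toLin'_apply, Matrix.toLin'_toMatrix']
  rfl

theorem linSubst_isHomogeneous_iff (e : (σ → k) ≃ₗ[k] (σ → k)) {d : ℕ} {G : MvPolynomial σ k} :
    (linSubst e G).IsHomogeneous d ↔ G.IsHomogeneous d := by
  have himp (f : (σ → k) ≃ₗ[k] (σ → k)) {H : MvPolynomial σ k} (hH : H.IsHomogeneous d) :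
      (linSubst f H).IsHomogeneous d := by
    have h := hH.aeval _ (Matrix.toMvPolynomial_isHomogeneous (LinearMap.toMatrix' f.toLinearMap))
    rwa [one_mul] at h
  refine ⟨fun h => ?_, himp e⟩
  rw [← (linSubst e).symm_apply_apply G]
  exact himp e.symm h

end LinearChange

section LinearChangePlane

variable {k : Type*} [Field k]

theorem vanishesAt_linSubst (e : (Fin 3 → k) ≃ₗ[k] (Fin 3 → k)) {d : ℕ}
    {G : MvPolynomial (Fin 3) k} (hG : G.IsHomogeneous d) (p : Plane k) :
    VanishesAt (linSubst e G) p ↔ VanishesAt G (e • p) := by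
  induction p using Projectivization.ind with
  | h v hv =>
    rw [Projectivization.smul_mk, vanishesAt_mk ((linSubst_isHomogeneous_iff e).2 hG),
      vanishesAt_mk hG, eval_linSubst]
    rfl

theorem map_linSubst_pointIdeal (e : (Fin 3 → k) ≃ₗ[k] (Fin 3 → k)) (p : Plane k) :
    (pointIdeal (e • p)).map (linSubst e) = pointIdeal p := by
  have hle (f : (Fin 3 → k) ≃ₗ[k] (Fin 3 → k)) (q : Plane k) :
      (pointIdeal (f • q)).map (linSubst f) ≤ pointIdeal q := by
    rw [Ideal.map_le_iff_le_comap, pointIdeal, Ideal.span_le]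
    rintro G ⟨d, hG, h⟩
    exact Ideal.subset_span
      ⟨d, (linSubst_isHomogeneous_iff f).2 hG, (vanishesAt_linSubst f hG q).2 h⟩
  refine (hle e p).antisymm fun G hG => ?_
  have hsymm := hle e⁻¹ (e • p)
  rw [inv_smul_smul] at hsymm
  rw [← (linSubst e).apply_symm_apply G]
  exact Ideal.mem_map_of_mem _ (hsymm (Ideal.mem_map_of_mem _ hG))

theorem linSubst_mem_pointIdeal_pow_iff (e : (Fin 3 → k) ≃ₗ[k] (Fin 3 → k)) {p : Plane k} {m : ℕ}
    {G : MvPolynomial (Fin 3) k} :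
    linSubst e G ∈ pointIdeal p ^ m ↔ G ∈ pointIdeal (e • p) ^ m := by
  rw [← map_linSubst_pointIdeal e p, ← Ideal.map_pow]
  exact Ideal.apply_mem_of_equiv_iff (f := (linSubst e).toRingEquiv)

theorem isSingularPoint_iff {d : ℕ} {G : MvPolynomial (Fin 3) k} (hG : G.IsHomogeneous d)
    (p : Plane k) : IsSingularPoint G p ↔ G ∈ pointIdeal p ^ 2 :=
  (mem_pointIdeal_sq_iff hG p).symm

theorem isSingularPoint_linSubst (e : (Fin 3 → k) ≃ₗ[k] (Fin 3 → k)) {d : ℕ}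
    {G : MvPolynomial (Fin 3) k} (hG : G.IsHomogeneous d) (p : Plane k) :
    IsSingularPoint (linSubst e G) p ↔ IsSingularPoint G (e • p) := by
  rw [isSingularPoint_iff hG, isSingularPoint_iff ((linSubst_isHomogeneous_iff e).2 hG),
    linSubst_mem_pointIdeal_pow_iff]

theorem linSubst_mem_fatIdeal_iff [DecidableEq (Plane k)] (e : (Fin 3 → k) ≃ₗ[k] (Fin 3 → k))
    {m : ℕ} {X : Finset (Plane k)} {G : MvPolynomial (Fin 3) k} :
    linSubst e G ∈ fatIdeal m X ↔ G ∈ fatIdeal m (e • X) := by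
  simp only [mem_fatIdeal, linSubst_mem_pointIdeal_pow_iff, Finset.mem_smul_finset,
    forall_exists_index, and_imp, forall_apply_eq_imp_iff₂]

/-- The homogeneous component of degree `d` of the homogeneous ideal `I`. -/
noncomputable def degreePart (I : Ideal (MvPolynomial (Fin 3) k)) (d : ℕ) :
    Submodule k (MvPolynomial (Fin 3) k) :=
  homogeneousSubmodule (Fin 3) k d ⊓ I.restrictScalars k

theorem mem_degreePart {I : Ideal (MvPolynomial (Fin 3) k)} {d : ℕ}
    {G : MvPolynomial (Fin 3) k} : G ∈ degreePart I d ↔ G.IsHomogeneous d ∧ G ∈ I :=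
  Iff.rfl

instance (d : ℕ) : Module.Finite k (homogeneousSubmodule (Fin 3) k d) :=
  Module.Finite.iff_fg.2 (homogeneousSubmodule_fg _ _ d)

instance (I : Ideal (MvPolynomial (Fin 3) k)) (d : ℕ) : Module.Finite k (degreePart I d) :=
  Submodule.finiteDimensional_inf_left _ _

theorem hilbertFn_add_finrank_degreePart (I : Ideal (MvPolynomial (Fin 3) k)) (d : ℕ) :
    hilbertFn I d + Module.finrank k (degreePart I d) =
      Module.finrank k (homogeneousSubmodule (Fin 3) k d) := by
  have hquot := Submodule.finrank_quotient_add_finrank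
    ((I.restrictScalars k).comap (homogeneousSubmodule (Fin 3) k d).subtype)
  rw [← Submodule.finrank_map_subtype_eq] at hquot
  rwa [Submodule.map_comap_subtype] at hquot

theorem hilbertFn_smul [DecidableEq (Plane k)] (e : (Fin 3 → k) ≃ₗ[k] (Fin 3 → k))
    (m : ℕ) (X : Finset (Plane k)) :
    hilbertFn (fatIdeal m (e • X)) = hilbertFn (fatIdeal m X) := by
  funext d
  have hmap : (degreePart (fatIdeal m (e • X)) d).map (linSubst e).toLinearEquiv.toLinearMap =
      degreePart (fatIdeal m X) d := by
    ext G
    obtain ⟨H, rfl⟩ := (linSubst e).surjective G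
    rw [mem_degreePart, linSubst_isHomogeneous_iff, linSubst_mem_fatIdeal_iff, ← mem_degreePart]
    exact (linSubst e).injective.mem_set_image
  have hfinrank := LinearEquiv.finrank_map_eq (linSubst e).toLinearEquiv
    (degreePart (fatIdeal m (e • X)) d)
  have h₁ := hilbertFn_add_finrank_degreePart (fatIdeal m X) d
  have h₂ := hilbertFn_add_finrank_degreePart (fatIdeal m (e • X)) d
  rw [hmap] at hfinrank
  lia

theorem doubleDiff_smul [DecidableEq (Plane k)] (e : (Fin 3 → k) ≃ₗ[k] (Fin 3 → k))
    (X : Finset (Plane k)) : doubleDiff (e • X) = doubleDiff X := by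
  rw [doubleDiff, hilbertFn_smul, doubleDiff]

/-- The difference functions of the double point schemes supported on `3t`, `3t + 1` and `3t + 2`
points of the curve `F = 0` that include `P`, with both possibilities occurring for `3t + 1`
points. -/
def HasTables (F : MvPolynomial (Fin 3) k) (P : Plane k) (t : ℕ) : Prop :=
  (∀ X : Finset (Plane k), P ∈ X → (∀ Q ∈ X, VanishesAt F Q) →
      (X.card = 3 * t → doubleDiff X = table0 t) ∧
      (X.card = 3 * t + 1 → doubleDiff X = table1a t ∨ doubleDiff X = table1b t) ∧
      (X.card = 3 * t + 2 → doubleDiff X = table2 t)) ∧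
    (∃ X : Finset (Plane k), P ∈ X ∧ (∀ Q ∈ X, VanishesAt F Q) ∧
      X.card = 3 * t + 1 ∧ doubleDiff X = table1a t) ∧
    (∃ X : Finset (Plane k), P ∈ X ∧ (∀ Q ∈ X, VanishesAt F Q) ∧
      X.card = 3 * t + 1 ∧ doubleDiff X = table1b t)

theorem HasTables.of_linSubst (e : (Fin 3 → k) ≃ₗ[k] (Fin 3 → k)) {d : ℕ}
    {F : MvPolynomial (Fin 3) k} (hF : F.IsHomogeneous d) {P : Plane k} {t : ℕ}
    (h : HasTables (linSubst e F) P t) : HasTables F (e • P) t := by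
  classical
  have hsmul {T : ℕ → ℤ} : (∃ X : Finset (Plane k), P ∈ X ∧
      (∀ Q ∈ X, VanishesAt (linSubst e F) Q) ∧ X.card = 3 * t + 1 ∧ doubleDiff X = T) →
      ∃ X : Finset (Plane k), e • P ∈ X ∧ (∀ Q ∈ X, VanishesAt F Q) ∧ X.card = 3 * t + 1 ∧
      doubleDiff X = T := by
    rintro ⟨X, hP, hX, hcard, hT⟩
    refine ⟨e • X, Finset.smul_mem_smul_finset hP, fun Q hQ => ?_,
      (Finset.card_smul_finset e X).trans hcard, (doubleDiff_smul e X).trans hT⟩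
    obtain ⟨R, hR, rfl⟩ := Finset.mem_smul_finset.1 hQ
    exact (vanishesAt_linSubst e hF R).1 (hX R hR)
  refine ⟨fun X hP hX => ?_, hsmul h.2.1, hsmul h.2.2⟩
  have htables := h.1 (e⁻¹ • X) (by rwa [← Finset.smul_mem_smul_finset_iff e, smul_inv_smul])
    (fun Q hQ => (vanishesAt_linSubst e hF Q).2 (hX _ (Finset.mem_inv_smul_finset_iff.1 hQ)))
  rwa [Finset.card_smul_finset, doubleDiff_smul] at htables

end LinearChangePlane

/-! ### Binary forms and the expansion of a form at a point -/

section BinaryForms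

variable {k : Type*} [Field k]

/-- The binary form of degree `n` in the coordinates `x₁, x₂` with dehomogenization `p`, where
`u = x₁ / x₂`. It is meaningful for `natDegree p ≤ n`; higher coefficients of `p` are dropped. -/
noncomputable def binaryForm (n : ℕ) : k[X] →ₗ[k] MvPolynomial (Fin 3) k :=
  (rename Fin.succ).toLinearMap ∘ₗ Polynomial.homogenizeLM n

theorem binaryForm_apply (n : ℕ) (p : k[X]) :
    binaryForm n p = rename Fin.succ (p.homogenize n) := rfl

theorem binaryForm_isHomogeneous (n : ℕ) (p : k[X]) : (binaryForm n p).IsHomogeneous n :=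
  (Polynomial.isHomogeneous_homogenize p).rename_isHomogeneous

theorem binaryForm_mul {m n : ℕ} {p r : k[X]} (hp : p.natDegree ≤ m) (hr : r.natDegree ≤ n) :
    binaryForm (m + n) (p * r) = binaryForm m p * binaryForm n r := by
  rw [binaryForm_apply, Polynomial.homogenize_mul p r hp hr, map_mul]
  rfl

theorem binaryForm_pow {n : ℕ} {p : k[X]} (hp : p.natDegree ≤ n) (j : ℕ) :
    binaryForm (n * j) (p ^ j) = binaryForm n p ^ j := by
  induction j with
  | zero => simp [binaryForm_apply]
  | succ j ih =>
    rw [pow_succ, pow_succ, mul_add_one,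
      binaryForm_mul (Polynomial.natDegree_pow_le_of_le j hp |>.trans_eq (mul_comm j n)) hp, ih]

theorem binaryForm_zero_left (p : k[X]) : binaryForm 0 p = C (p.coeff 0) := by
  simp [binaryForm_apply, Polynomial.homogenize, ← C_apply]

theorem binaryForm_one_left (p : k[X]) :
    binaryForm 1 p = C (p.coeff 1) * X 1 + C (p.coeff 0) * X 2 := by
  simp [binaryForm_apply, Polynomial.homogenize, Finset.Nat.antidiagonal_succ,
    Finsupp.update_eq_add_single, rename_monomial, C_mul_X_eq_monomial, add_comm]

theorem aeval_binaryForm {A : Type*} [CommRing A] [Algebra k A] {n : ℕ} {p : k[X]}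
    (hp : p.natDegree ≤ n) (w s x : A) :
    aeval ![w, x * s, s] (binaryForm n p) = s ^ n * Polynomial.aeval x p := by
  have hvec : ![w, x * s, s] ∘ Fin.succ = fun i => s * ![x, 1] i := by
    funext i
    fin_cases i <;> simp [mul_comm]
  rw [binaryForm_apply, aeval_rename, hvec,
    aeval_mul_of_isHomogeneous (Polynomial.isHomogeneous_homogenize p),
    Polynomial.aeval_homogenize_of_eq_one hp _ rfl]
  rfl

theorem eval_binaryForm_infinity (n : ℕ) (p : k[X]) (w x : k) :
    eval ![w, x, 0] (binaryForm n p) = p.coeff n * x ^ n := by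
  have hvec : ![w, x, 0] ∘ Fin.succ = ![x, 0] := by
    funext i
    fin_cases i <;> rfl
  rw [binaryForm_apply, eval_rename, hvec, Polynomial.homogenize, map_sum,
    Finset.sum_eq_single (n, 0)]
  · simp [eval_monomial, Finsupp.prod_fintype]
  · intro ij hij hne
    have hj : ij.2 ≠ 0 := fun hj => hne (Prod.ext (by simpa [hj] using hij) hj)
    simp [eval_monomial, Finsupp.prod_fintype, hj]
  · simp

theorem finSuccEquiv_rename_succ (n : ℕ) (H : MvPolynomial (Fin n) k) :
    finSuccEquiv k n (rename Fin.succ H) = Polynomial.C H := by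
  induction H using MvPolynomial.induction_on with
  | C a =>
    rw [rename_C]
    exact (finSuccEquiv k n).commutes a
  | add p r hp hr => rw [map_add, map_add, hp, hr, Polynomial.C_add]
  | mul_X p i hp =>
    rw [map_mul, map_mul, hp, rename_X, finSuccEquiv_X_succ, Polynomial.C_mul]

/-- The polynomial in `u = x₁ / x₂` that is the dehomogenized coefficient of `x₀ ^ j` in `G`. -/
noncomputable def slice (G : MvPolynomial (Fin 3) k) (j : ℕ) : k[X] :=
  aeval ![Polynomial.X, 1] ((finSuccEquiv k 2 G).coeff j)

theorem natDegree_slice_le {d j : ℕ} {G : MvPolynomial (Fin 3) k} (hG : G.IsHomogeneous d)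
    (hj : j ≤ d) : (slice G j).natDegree ≤ d - j := by
  have hcoeff := hG.finSuccEquiv_coeff_isHomogeneous j (d - j) (Nat.add_sub_cancel' hj)
  refine (aeval_natDegree_le _ hcoeff.totalDegree_le _ (n := 1) fun i => ?_).trans_eq (mul_one _)
  fin_cases i <;> simp

theorem eq_sum_slice {d : ℕ} {G : MvPolynomial (Fin 3) k} (hG : G.IsHomogeneous d) :
    G = ∑ j ∈ Finset.range (d + 1), X 0 ^ j * binaryForm (d - j) (slice G j) := by
  have hdeg : (finSuccEquiv k 2 G).natDegree < d + 1 := by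
    rw [natDegree_finSuccEquiv, Nat.lt_succ_iff]
    exact (degreeOf_le_totalDegree G 0).trans hG.totalDegree_le
  apply (finSuccEquiv k 2).injective
  conv_lhs => rw [(finSuccEquiv k 2 G).as_sum_range_C_mul_X_pow' hdeg]
  rw [map_sum]
  refine Finset.sum_congr rfl fun j hj => ?_
  have hj : j ≤ d := Nat.lt_succ_iff.1 (Finset.mem_range.1 hj)
  rw [map_mul, map_pow, finSuccEquiv_X_zero, binaryForm_apply, slice,
    Polynomial.homogenize_eq_of_isHomogeneous
      (hG.finSuccEquiv_coeff_isHomogeneous j (d - j) (Nat.add_sub_cancel' hj)) rfl,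
    finSuccEquiv_rename_succ, mul_comm]

end BinaryForms

section Apex

variable {k : Type*} [Field k]

theorem pderiv_zero_binaryForm (n : ℕ) (p : k[X]) : pderiv 0 (binaryForm n p) = 0 := by
  classical
  refine pderiv_eq_zero_of_notMem_vars fun h => ?_
  obtain ⟨i, -, hi⟩ := Finset.mem_image.1 (vars_rename Fin.succ _ h)
  exact Fin.succ_ne_zero i hi

theorem doubleAt_binaryForm {n : ℕ} (hn : 2 ≤ n) (p : k[X]) (w : k) :
    DoubleAt ![w, 0, 0] (binaryForm n p) := by
  refine ⟨by rw [eval_binaryForm_infinity, zero_pow (by lia), mul_zero], Fin.cases ?_ fun i => ?_⟩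
  · rw [pderiv_zero_binaryForm, map_zero]
  · have hvec : ![w, 0, 0] ∘ Fin.succ = (0 : Fin 2 → k) := by
      funext i
      fin_cases i <;> rfl
    have hdeg : (pderiv i (p.homogenize n)).IsHomogeneous (n - 1) :=
      (Polynomial.isHomogeneous_homogenize p).pderiv
    rw [binaryForm_apply, pderiv_rename (Fin.succ_injective 2), eval_rename, hvec, eval_zero,
      constantCoeff_eq]
    exact hdeg.coeff_eq_zero (by rw [map_zero]; lia)

theorem doubleAt_apexVec_iff {d : ℕ} {G : MvPolynomial (Fin 3) k} (hG : G.IsHomogeneous d) :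
    DoubleAt ![1, 0, 0] G ↔ slice G d = 0 ∧ slice G (d - 1) = 0 := by
  have hconst : slice G d = Polynomial.C ((slice G d).coeff 0) :=
    Polynomial.eq_C_of_natDegree_le_zero ((natDegree_slice_le hG le_rfl).trans_eq (Nat.sub_self d))
  conv_lhs => rw [eq_sum_slice hG]
  rcases d with _ | d
  · rw [hconst]
    simp [DoubleAt, binaryForm_zero_left]
  have hlin : slice G d = Polynomial.C ((slice G d).coeff 1) * Polynomial.X +
      Polynomial.C ((slice G d).coeff 0) :=
    Polynomial.eq_X_add_C_of_natDegree_le_one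
      ((natDegree_slice_le hG d.le_succ).trans_eq (Nat.add_sub_cancel_left d 1))
  rw [Finset.sum_range_succ, Finset.sum_range_succ, add_assoc, doubleAt_add_iff, Nat.sub_self,
    Nat.add_sub_cancel_left, Nat.add_sub_cancel, hconst, hlin, binaryForm_zero_left,
    binaryForm_one_left]
  · have hlinear (a b : k) : Polynomial.C a * Polynomial.X + Polynomial.C b = 0 ↔ a = 0 ∧ b = 0 :=
      ⟨fun h => ⟨by simpa using congr_arg (Polynomial.coeff · 1) h,
        by simpa using congr_arg (Polynomial.coeff · 0) h⟩, fun ⟨ha, hb⟩ => by simp [ha, hb]⟩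
    rw [hlinear, Polynomial.C_eq_zero]
    generalize (slice G d).coeff 1 = a, (slice G d).coeff 0 = b, (slice G (d + 1)).coeff 0 = c
    refine ⟨fun h => ⟨?_, ?_, ?_⟩, ?_⟩
    · simpa using h.1
    · simpa [pderiv_X] using h.2 1
    · simpa [pderiv_X] using h.2 2
    · rintro ⟨rfl, rfl, rfl⟩
      simp [DoubleAt]
  · refine DoubleAt.sum fun j hj => (doubleAt_binaryForm ?_ _ _).mul_left _
    have := Finset.mem_range.1 hj
    lia

/-- The plane cubic `x₀ q(x₁, x₂) + c(x₁, x₂)`, which is singular at `(1 : 0 : 0)` with tangent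
cone `q = 0`. -/
noncomputable def cubicForm (q c : k[X]) : MvPolynomial (Fin 3) k :=
  X 0 * binaryForm 2 q + binaryForm 3 c

theorem cubicForm_isHomogeneous (q c : k[X]) : (cubicForm q c).IsHomogeneous 3 :=
  ((isHomogeneous_X k 0).mul (binaryForm_isHomogeneous 2 q)).add (binaryForm_isHomogeneous 3 c)

theorem eq_cubicForm_of_doubleAt {F : MvPolynomial (Fin 3) k} (hF : F.IsHomogeneous 3)
    (hdouble : DoubleAt ![1, 0, 0] F) : F = cubicForm (slice F 1) (slice F 0) := by
  obtain ⟨h₃, h₂⟩ := (doubleAt_apexVec_iff hF).1 hdouble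
  conv_lhs => rw [eq_sum_slice hF]
  simp [Finset.sum_range_succ, h₂, h₃, cubicForm, add_comm]

end Apex

/-! ### The normal form of a singular cubic -/

section NormalForm

variable {k : Type*} [Field k]

theorem not_isUnit_of_isHomogeneous {σ : Type*} {d : ℕ} (hd : d ≠ 0) {G : MvPolynomial σ k}
    (hG : G.IsHomogeneous d) : ¬IsUnit G := fun h =>
  (h.map constantCoeff).ne_zero (hG.coeff_eq_zero (by rw [map_zero]; exact hd.symm))

theorem not_irreducible_cubicForm_mul {r q c : k[X]} (hr : r.natDegree ≤ 1)
    (hq : q.natDegree ≤ 1) (hc : c.natDegree ≤ 2) : ¬Irreducible (cubicForm (r * q) (r * c)) := by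
  have hfactor : cubicForm (r * q) (r * c) =
      binaryForm 1 r * (X 0 * binaryForm 1 q + binaryForm 2 c) := by
    rw [cubicForm, binaryForm_mul (m := 1) (n := 1) hr hq, binaryForm_mul (m := 1) (n := 2) hr hc]
    ring
  have hcofactor : (X 0 * binaryForm 1 q + binaryForm 2 c).IsHomogeneous 2 :=
    ((isHomogeneous_X k 0).mul (binaryForm_isHomogeneous 1 q)).add (binaryForm_isHomogeneous 2 c)
  exact fun h => (h.isUnit_or_isUnit hfactor).elim
    (not_isUnit_of_isHomogeneous one_ne_zero (binaryForm_isHomogeneous 1 r))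
    (not_isUnit_of_isHomogeneous two_ne_zero hcofactor)

/-- The pair `(q, c)` presents an irreducible cubic `x₀ q + c` in coordinates where the line
`x₂ = 0` is a tangent at the singular point `(1 : 0 : 0)`: this is the bound on the degree of
`q`, while the two other conditions say that the cubic contains no line through that point. -/
structure IsNormalPair (q c : k[X]) : Prop where
  natDegree_left_le : q.natDegree ≤ 1
  natDegree_right : c.natDegree = 3
  isCoprime : IsCoprime q c

theorem isNormalPair_of_irreducible [IsAlgClosed k] {q c : k[X]} (hq : q.natDegree ≤ 1)
    (hc : c.natDegree ≤ 3) (hirr : Irreducible (cubicForm q c)) : IsNormalPair q c := by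
  refine ⟨hq, hc.antisymm (Nat.succ_le_of_lt (not_le.1 fun hc₂ => ?_)), ?_⟩
  · rw [← one_mul q, ← one_mul c] at hirr
    exact not_irreducible_cubicForm_mul (by simp) hq hc₂ hirr
  · refine (Polynomial.isCoprime_iff_aeval_ne_zero_of_isAlgClosed k k q c).2 fun z => ?_
    by_contra! hz
    have hdeg (p : k[X]) : (p /ₘ (Polynomial.X - Polynomial.C z)).natDegree = p.natDegree - 1 := by
      rw [Polynomial.natDegree_divByMonic _ (Polynomial.monic_X_sub_C z),
        Polynomial.natDegree_X_sub_C]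
    rw [← Polynomial.mul_divByMonic_eq_iff_isRoot.2 hz.1,
      ← Polynomial.mul_divByMonic_eq_iff_isRoot.2 hz.2] at hirr
    exact not_irreducible_cubicForm_mul (by simp) (by rw [hdeg]; lia) (by rw [hdeg]; lia) hirr

/-- The point `(1 : 0 : 0)`. -/
noncomputable def apex : Plane k :=
  Projectivization.mk k ![1, 0, 0] fun h => one_ne_zero (congr_fun h 0)

theorem isSingularPoint_apex_iff {d : ℕ} {G : MvPolynomial (Fin 3) k} (hG : G.IsHomogeneous d) :
    IsSingularPoint G apex ↔ DoubleAt ![1, 0, 0] G := by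
  rw [isSingularPoint_iff hG, apex, mem_pointIdeal_mk_sq_iff hG]

theorem exists_eq_cubicForm {F : MvPolynomial (Fin 3) k} (hF : F.IsHomogeneous 3)
    (h : IsSingularPoint F apex) :
    ∃ q c : k[X], q.natDegree ≤ 2 ∧ c.natDegree ≤ 3 ∧ F = cubicForm q c :=
  ⟨slice F 1, slice F 0, natDegree_slice_le hF (by simp), natDegree_slice_le hF (by simp),
    eq_cubicForm_of_doubleAt hF ((isSingularPoint_apex_iff hF).1 h)⟩

theorem eval_cubicForm {q c : k[X]} (hq : q.natDegree ≤ 2) (hc : c.natDegree ≤ 3) (w s x : k) :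
    eval ![w, x * s, s] (cubicForm q c) = w * (s ^ 2 * q.eval x) + s ^ 3 * c.eval x := by
  have h₂ := aeval_binaryForm hq w s x
  have h₃ := aeval_binaryForm hc w s x
  simp only [aeval_eq_eval, Polynomial.coe_aeval_eq_eval] at h₂ h₃
  rw [cubicForm, map_add, map_mul, h₂, h₃, eval_X, Matrix.cons_val_zero]

theorem eval_cubicForm_infinity (q c : k[X]) (w x : k) :
    eval ![w, x, 0] (cubicForm q c) = w * (q.coeff 2 * x ^ 2) + c.coeff 3 * x ^ 3 := by
  rw [cubicForm, map_add, map_mul, eval_binaryForm_infinity, eval_binaryForm_infinity, eval_X,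
    Matrix.cons_val_zero]

theorem exists_tangent_direction [IsAlgClosed k] {q c : k[X]} (hq : q.natDegree ≤ 2)
    (hc : c.natDegree ≤ 3) : ∃ x y : k, (x ≠ 0 ∨ y ≠ 0) ∧ ∀ w a : k,
      eval ![w, x * a, y * a] (cubicForm q c) = eval ![0, x * a, y * a] (cubicForm q c) := by
  by_cases h2 : q.coeff 2 = 0
  · refine ⟨1, 0, Or.inl one_ne_zero, fun w a => ?_⟩
    simp only [zero_mul, eval_cubicForm_infinity, h2, mul_zero]
  · have hdeg : q.degree ≠ 0 := fun h =>
      h2 (Polynomial.coeff_eq_zero_of_natDegree_lt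
        ((Polynomial.natDegree_eq_zero_iff_degree_le_zero.2 h.le).trans_lt two_pos))
    obtain ⟨z, hz⟩ := IsAlgClosed.exists_root q hdeg
    refine ⟨z, 1, Or.inr one_ne_zero, fun w a => ?_⟩
    rw [one_mul, eval_cubicForm hq hc, eval_cubicForm hq hc, hz.eq_zero, mul_zero, mul_zero,
      mul_zero]

theorem exists_linearEquiv_smul_apex {x y : k} (hxy : x ≠ 0 ∨ y ≠ 0) :
    ∃ e : (Fin 3 → k) ≃ₗ[k] (Fin 3 → k), e • (apex : Plane k) = apex ∧
      ∃ a b : k, ∀ w, e ![w, 1, 0] = ![w * b, x * a, y * a] := by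
  have hne {v : Fin 3 → k} (hv : v ≠ 0) (h0 : v 0 = 0) :
      apex ≠ Projectivization.mk k v hv := fun h => by
    obtain ⟨a, ha⟩ := (Projectivization.mk_eq_mk_iff' k _ _ _ hv).1 h
    simpa [h0] using congr_fun ha 0
  have hinf : (![0, 1, 0] : Fin 3 → k) ≠ 0 := fun h => one_ne_zero (congr_fun h 1)
  have hdir : (![0, x, y] : Fin 3 → k) ≠ 0 := fun h =>
    hxy.elim (· (congr_fun h 1)) (· (congr_fun h 2))
  obtain ⟨e, hapex, hinfty⟩ := MulAction.is_two_pretransitive_iff.1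
    (Projectivization.linearEquiv_is_two_pretransitive k (Fin 3 → k))
    (hne hinf rfl) (hne hdir rfl)
  refine ⟨e, hapex, ?_⟩
  rw [apex, Projectivization.smul_mk, Projectivization.mk_eq_mk_iff'] at hapex
  rw [Projectivization.smul_mk, Projectivization.mk_eq_mk_iff'] at hinfty
  obtain ⟨b, hb : b • ![1, 0, 0] = e ![1, 0, 0]⟩ := hapex
  obtain ⟨a, ha : a • ![0, x, y] = e ![0, 1, 0]⟩ := hinfty
  refine ⟨a, b, fun w => ?_⟩
  have hsplit : (![w, 1, 0] : Fin 3 → k) = w • ![1, 0, 0] + ![0, 1, 0] := by simp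
  rw [hsplit, map_add, map_smul, ← ha, ← hb]
  simp [mul_comm]

theorem exists_linSubst_eq_cubicForm [IsAlgClosed k] {F : MvPolynomial (Fin 3) k}
    (hF : F.IsHomogeneous 3) (hirr : Irreducible F) {P : Plane k} (hP : IsSingularPoint F P) :
    ∃ (e : (Fin 3 → k) ≃ₗ[k] (Fin 3 → k)) (q c : k[X]),
      e • apex = P ∧ IsNormalPair q c ∧ linSubst e F = cubicForm q c := by
  have := MulAction.isPretransitive_of_is_two_pretransitive
    (h2 := Projectivization.linearEquiv_is_two_pretransitive k (Fin 3 → k))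
  obtain ⟨e₁, rfl⟩ := MulAction.exists_smul_eq ((Fin 3 → k) ≃ₗ[k] (Fin 3 → k)) apex P
  have hform (e : (Fin 3 → k) ≃ₗ[k] (Fin 3 → k)) (he : e • apex = e₁ • (apex : Plane k)) :
      ∃ q c : k[X], q.natDegree ≤ 2 ∧ c.natDegree ≤ 3 ∧ linSubst e F = cubicForm q c :=
    exists_eq_cubicForm ((linSubst_isHomogeneous_iff e).2 hF)
      ((isSingularPoint_linSubst e hF apex).2 (he ▸ hP))
  obtain ⟨q₁, c₁, hq₁, hc₁, h₁⟩ := hform e₁ rfl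
  obtain ⟨x, y, hxy, hdir⟩ := exists_tangent_direction hq₁ hc₁
  obtain ⟨e₂, he₂, a, b, hline⟩ := exists_linearEquiv_smul_apex hxy
  have he : (e₁ * e₂) • (apex : Plane k) = e₁ • apex := by rw [mul_smul, he₂]
  obtain ⟨q, c, hq, hc, h₂⟩ := hform (e₁ * e₂) he
  have heval (w : k) : eval ![w, 1, 0] (cubicForm q c) =
      eval ![w * b, x * a, y * a] (cubicForm q₁ c₁) := by
    rw [← h₁, ← h₂, eval_linSubst, eval_linSubst, ← hline]
    rfl
  have hcoeff : q.coeff 2 = 0 := by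
    have h := (heval 1).trans (((hdir _ a).trans (hdir (0 * b) a).symm).trans (heval 0).symm)
    simpa only [eval_cubicForm_infinity, one_pow, mul_one, one_mul, zero_mul, add_left_inj] using h
  refine ⟨e₁ * e₂, q, c, he, isNormalPair_of_irreducible
    (Polynomial.natDegree_le_pred hq hcoeff) hc ?_, h₂⟩
  rw [← h₂]
  exact (MulEquiv.irreducible_iff (linSubst (e₁ * e₂))).2 hirr

end NormalForm

/-! ### Polynomials of bounded degree -/

section BoundedMultiples

open Polynomial

variable {k : Type*} [Field k]

theorem finrank_degreeLT (n : ℕ) : Module.finrank k (degreeLT k n) = n := by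
  rw [(degreeLTEquiv k n).finrank_eq, Module.finrank_fin_fun]

theorem mem_degreeLT_succ {n : ℕ} {f : k[X]} : f ∈ degreeLT k (n + 1) ↔ f.natDegree ≤ n := by
  rw [degreeLT_succ_eq_degreeLE, mem_degreeLE, natDegree_le_iff_degree_le]

theorem mem_degreeLT_iff_coeff_eq_zero {n : ℕ} {f : k[X]}
    (hf : f ∈ degreeLT k (n + 1)) :
    f ∈ degreeLT k n ↔ f.coeff n = 0 := by
  rw [mem_degreeLT, degree_lt_iff_coeff_zero] at hf ⊢
  exact ⟨fun h => h n le_rfl, fun h m hm => (eq_or_lt_of_le hm).elim (fun e => e ▸ h) (hf m)⟩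

theorem mem_degreeLT_zero {f : k[X]} : f ∈ degreeLT k 0 ↔ f = 0 := by
  rw [mem_degreeLT, Nat.cast_zero, ← not_le, zero_le_degree_iff, not_not]

theorem natDegree_lt_of_mem_degreeLT {n : ℕ} {f : k[X]} (h : f ∈ degreeLT k n) (hf : f ≠ 0) :
    f.natDegree < n := by
  rwa [mem_degreeLT, degree_eq_natDegree hf, Nat.cast_lt] at h

theorem mul_mem_degreeLT {f g : k[X]} {m n N : ℕ} (hf : f.natDegree ≤ m) (hg : g ∈ degreeLT k n)
    (hN : m + n ≤ N) : f * g ∈ degreeLT k N := by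
  rcases eq_or_ne g 0 with rfl | hg0
  · rw [mul_zero]
    exact zero_mem _
  · have := natDegree_lt_of_mem_degreeLT hg hg0
    rw [← Nat.sub_add_cancel (by lia : 1 ≤ N), mem_degreeLT_succ]
    exact natDegree_mul_le.trans (by lia)

theorem mul_mem_degreeLT_iff {f g : k[X]} (hf : f ≠ 0) {n : ℕ} :
    f * g ∈ degreeLT k (f.natDegree + n) ↔ g ∈ degreeLT k n := by
  refine ⟨fun h => ?_, fun h => mul_mem_degreeLT le_rfl h le_rfl⟩
  rcases eq_or_ne g 0 with rfl | hg
  · exact zero_mem _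
  · have := natDegree_lt_of_mem_degreeLT h (mul_ne_zero hf hg)
    rw [natDegree_mul hf hg] at this
    rw [mem_degreeLT, degree_eq_natDegree hg, Nat.cast_lt]
    lia

/-- The space of multiples `f * g` with `g` of degree less than `n`. -/
noncomputable def boundedMultiples (f : k[X]) (n : ℕ) : Submodule k k[X] :=
  (degreeLT k n).map (LinearMap.mulLeft k f)

theorem mem_boundedMultiples {f x : k[X]} {n : ℕ} :
    x ∈ boundedMultiples f n ↔ ∃ g ∈ degreeLT k n, f * g = x :=
  Iff.rfl

instance (f : k[X]) (n : ℕ) : Module.Finite k (boundedMultiples f n) :=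
  inferInstanceAs (Module.Finite k ((degreeLT k n).map _))

theorem finrank_boundedMultiples {f : k[X]} (hf : f ≠ 0) (n : ℕ) :
    Module.finrank k (boundedMultiples f n) = n := by
  rw [boundedMultiples, ← (Submodule.equivMapOfInjective (LinearMap.mulLeft k f)
    (mul_right_injective₀ hf) (degreeLT k n)).finrank_eq, finrank_degreeLT]

theorem boundedMultiples_one (f : k[X]) : boundedMultiples f 1 = k ∙ f := by
  ext x
  rw [mem_boundedMultiples, Submodule.mem_span_singleton]
  constructor
  · rintro ⟨g, hg, rfl⟩
    rw [← zero_add 1, mem_degreeLT_succ] at hg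
    exact ⟨g.coeff 0, by rw [Polynomial.smul_eq_C_mul, ← eq_C_of_natDegree_le_zero hg, mul_comm]⟩
  · rintro ⟨a, rfl⟩
    refine ⟨C a, ?_, by rw [Polynomial.smul_eq_C_mul, mul_comm]⟩
    rw [← zero_add 1, mem_degreeLT_succ, natDegree_C]

theorem mem_boundedMultiples_sub_natDegree {f x : k[X]} (hf : f ≠ 0) {n : ℕ} :
    x ∈ boundedMultiples f (n - f.natDegree) ↔ f ∣ x ∧ x ∈ degreeLT k n := by
  rcases le_total f.natDegree n with hn | hn
  · obtain ⟨m, rfl⟩ := Nat.exists_eq_add_of_le hn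
    rw [Nat.add_sub_cancel_left]
    constructor
    · rintro ⟨g, hg, rfl⟩
      exact ⟨dvd_mul_right f g, (mul_mem_degreeLT_iff hf).2 hg⟩
    · rintro ⟨⟨g, rfl⟩, hg⟩
      exact ⟨g, (mul_mem_degreeLT_iff hf).1 hg, rfl⟩
  · rw [Nat.sub_eq_zero_of_le hn]
    constructor
    · rintro ⟨g, hg, rfl⟩
      rw [mem_degreeLT_zero.1 hg, map_zero]
      exact ⟨dvd_zero f, zero_mem _⟩
    · rintro ⟨hdvd, hx⟩
      rw [Polynomial.eq_zero_of_dvd_of_degree_lt hdvd]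
      · exact zero_mem _
      · rw [Polynomial.degree_eq_natDegree hf]
        exact (Polynomial.mem_degreeLT.1 hx).trans_le (by exact_mod_cast hn)

theorem mem_boundedMultiples_mul_iff {f g x : k[X]} (hfg : IsCoprime f g) (hf : f ≠ 0)
    (hg : g ≠ 0) {n : ℕ} :
    x ∈ boundedMultiples (f * g) (n - g.natDegree) ↔ x ∈ boundedMultiples f n ∧ g ∣ x := by
  have hfn := mem_boundedMultiples_sub_natDegree (x := x) hf (n := f.natDegree + n)
  have hfgn := mem_boundedMultiples_sub_natDegree (x := x) (mul_ne_zero hf hg)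
    (n := f.natDegree + n)
  rw [Nat.add_sub_cancel_left] at hfn
  rw [natDegree_mul hf hg, Nat.add_sub_add_left] at hfgn
  have hdvd : f * g ∣ x ↔ f ∣ x ∧ g ∣ x :=
    ⟨fun h => ⟨dvd_of_mul_right_dvd h, dvd_of_mul_left_dvd h⟩, fun h => hfg.mul_dvd h.1 h.2⟩
  rw [hfgn, hfn, hdvd, and_right_comm]

theorem boundedMultiples_le_degreeLT {f : k[X]} {m n N : ℕ} (hf : f.natDegree ≤ m)
    (hN : m + n ≤ N) : boundedMultiples f n ≤ degreeLT k N := by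
  rintro _ ⟨g, hg, rfl⟩
  exact mul_mem_degreeLT hf hg hN

theorem boundedMultiples_sup_of_isCoprime {p q : k[X]} (hpq : IsCoprime p q) (hp : p ≠ 0)
    (hq : q ≠ 0) {a : ℕ} (ha : q.natDegree ≤ a) (e : ℕ) :
    boundedMultiples p (a + e) ⊔ boundedMultiples q (p.natDegree + e) =
      degreeLT k (p.natDegree + (a + e)) := by
  have hinf : boundedMultiples p (a + e) ⊓ boundedMultiples q (p.natDegree + e) ≤
      boundedMultiples (p * q) e := by
    rintro _ ⟨⟨s, -, rfl⟩, ⟨t, ht, hst⟩⟩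
    rw [LinearMap.mulLeft_apply, LinearMap.mulLeft_apply] at hst
    obtain ⟨r, rfl⟩ := hpq.symm.dvd_of_dvd_mul_left (Dvd.intro t hst)
    have htr : t = p * r := mul_left_cancel₀ hq (by rw [hst]; ring)
    rw [htr, SetLike.mem_coe, mul_mem_degreeLT_iff hp] at ht
    exact ⟨r, ht, mul_assoc p q r⟩
  refine Submodule.eq_of_le_of_finrank_le (sup_le (boundedMultiples_le_degreeLT le_rfl le_rfl)
    (boundedMultiples_le_degreeLT ha (by lia))) ?_
  have hsum := Submodule.finrank_sup_add_finrank_inf_eq (boundedMultiples p (a + e))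
    (boundedMultiples q (p.natDegree + e))
  have hle := Submodule.finrank_mono hinf
  rw [finrank_boundedMultiples (mul_ne_zero hp hq)] at hle
  rw [finrank_boundedMultiples hp, finrank_boundedMultiples hq] at hsum
  rw [finrank_degreeLT]
  lia

end BoundedMultiples

/-! ### Forms restricted to the curve -/

section Pullback

variable {k : Type*} [Field k] {q c : k[X]}

/-- The pullback of forms along the parametrization `u ↦ (-c u : u q u : q u)` of the cubic
`x₀ q + c = 0` away from `(1 : 0 : 0)`. -/
noncomputable def pullback (q c : k[X]) : MvPolynomial (Fin 3) k →ₐ[k] k[X] :=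
  aeval ![-c, Polynomial.X * q, q]

theorem pullback_binaryForm {n : ℕ} {p : k[X]} (hp : p.natDegree ≤ n) :
    pullback q c (binaryForm n p) = q ^ n * p := by
  rw [pullback, aeval_binaryForm hp, Polynomial.aeval_X_left_apply]

theorem pullback_X_zero : pullback q c (X 0) = -c := by
  rw [pullback, aeval_X, Matrix.cons_val_zero]

theorem pullback_cubicForm (hq : q.natDegree ≤ 2) (hc : c.natDegree ≤ 3) :
    pullback q c (cubicForm q c) = 0 := by
  rw [cubicForm, map_add, map_mul, pullback_X_zero, pullback_binaryForm hq, pullback_binaryForm hc]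
  ring

theorem pullback_eq_sum {d : ℕ} {G : MvPolynomial (Fin 3) k} (hG : G.IsHomogeneous d) :
    pullback q c G = ∑ j ∈ Finset.range (d + 1), (-c) ^ j * (q ^ (d - j) * slice G j) := by
  conv_lhs => rw [eq_sum_slice hG, map_sum]
  refine Finset.sum_congr rfl fun j hj => ?_
  rw [map_mul, map_pow, pullback_X_zero,
    pullback_binaryForm (natDegree_slice_le hG (Nat.lt_succ_iff.1 (Finset.mem_range.1 hj)))]

/-- Homogeneous coordinates of the point with parameter `u` on the cubic `x₀ q + c = 0`. -/
def curveVec (q c : k[X]) (u : k) : Fin 3 → k :=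
  ![-c.eval u, u * q.eval u, q.eval u]

theorem curveVec_one (u : k) : curveVec q c u 1 = u * q.eval u :=
  rfl

theorem curveVec_two (u : k) : curveVec q c u 2 = q.eval u :=
  rfl

theorem eval_pullback (u : k) (G : MvPolynomial (Fin 3) k) :
    (pullback q c G).eval u = eval (curveVec q c u) G := by
  have hcomp : (Polynomial.aeval u).comp (pullback q c) =
      aeval (curveVec q c u) := by
    refine algHom_ext fun i => ?_
    fin_cases i <;> simp [pullback, curveVec]
  rw [← Polynomial.coe_aeval_eq_eval, ← aeval_eq_eval]
  exact DFunLike.congr_fun hcomp G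

/-- The polynomials `a (-c) ^ d + q g` with `a` constant and `g` of degree at most `3 d - 2`, which
are the pullbacks of the forms of degree `d`. -/
noncomputable def curveForms (q c : k[X]) (d : ℕ) : Submodule k k[X] :=
  k ∙ (-c) ^ d ⊔ boundedMultiples q (3 * d - 1)

instance (d : ℕ) : Module.Finite k (curveForms q c d) :=
  Submodule.finite_sup _ _

theorem mem_curveForms {d : ℕ} {f : k[X]} : f ∈ curveForms q c d ↔
    ∃ a : k, ∃ g ∈ Polynomial.degreeLT k (3 * d - 1), (-c) ^ d * Polynomial.C a + q * g = f := by
  constructor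
  · intro hf
    obtain ⟨_, hx, y, hy, rfl⟩ := Submodule.mem_sup.1 hf
    obtain ⟨a, rfl⟩ := Submodule.mem_span_singleton.1 hx
    obtain ⟨g, hg, rfl⟩ := mem_boundedMultiples.1 hy
    exact ⟨a, g, hg, by rw [Polynomial.smul_eq_C_mul, mul_comm]⟩
  · rintro ⟨a, g, hg, rfl⟩
    rw [mul_comm, ← Polynomial.smul_eq_C_mul]
    exact Submodule.add_mem_sup (Submodule.smul_mem _ a (Submodule.mem_span_singleton_self _))
      ⟨g, hg, rfl⟩

theorem boundedMultiples_le_curveForms (q c : k[X]) (d : ℕ) :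
    boundedMultiples q (3 * d - 1) ≤ curveForms q c d :=
  le_sup_right

end Pullback

namespace IsNormalPair

variable {k : Type*} [Field k] {q c : k[X]} (h : IsNormalPair q c)
include h

theorem left_ne_zero : q ≠ 0 := by
  rintro rfl
  have hdeg := h.natDegree_right
  rw [Polynomial.natDegree_eq_zero_of_isUnit (isCoprime_zero_left.1 h.isCoprime)] at hdeg
  exact absurd hdeg (by simp)

theorem right_ne_zero : c ≠ 0 := by
  rintro rfl
  exact absurd h.natDegree_right (by simp)

theorem natDegree_neg_right_pow (j : ℕ) : ((-c) ^ j).natDegree = 3 * j := by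
  rw [Polynomial.natDegree_pow, Polynomial.natDegree_neg, h.natDegree_right, mul_comm]

theorem neg_right_pow_ne_zero (j : ℕ) : (-c) ^ j ≠ 0 :=
  pow_ne_zero j (neg_ne_zero.2 h.right_ne_zero)

theorem neg_right_pow_mul_mem_degreeLT_iff {j n : ℕ} {f : k[X]} :
    (-c) ^ j * f ∈ Polynomial.degreeLT k (3 * j + n) ↔ f ∈ Polynomial.degreeLT k n := by
  rw [← h.natDegree_neg_right_pow, mul_mem_degreeLT_iff (h.neg_right_pow_ne_zero j)]

theorem neg_right_pow_mul_mem_degreeLT_self_iff {j : ℕ} {f : k[X]} :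
    (-c) ^ j * f ∈ Polynomial.degreeLT k (3 * j) ↔ f = 0 := by
  rw [← Nat.add_zero (3 * j), h.neg_right_pow_mul_mem_degreeLT_iff, mem_degreeLT_zero]

theorem isCoprime_neg_right_pow (j : ℕ) : IsCoprime q ((-c) ^ j) :=
  h.isCoprime.neg_right.pow_right

theorem boundedMultiples_left_le_degreeLT (d : ℕ) :
    boundedMultiples q (3 * d - 1) ≤ Polynomial.degreeLT k (3 * d) := by
  rcases d.eq_zero_or_pos with rfl | hd
  · rintro _ ⟨g, hg, rfl⟩
    rw [mem_degreeLT_zero.1 hg, map_zero]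
    exact zero_mem _
  · exact boundedMultiples_le_degreeLT h.natDegree_left_le (by lia)

theorem exists_sum_eq_pow_mul {d m : ℕ} (hm : m ≤ d) {s : ℕ → k[X]}
    (hs : ∀ j < m, (s j).natDegree ≤ d - j) :
    ∃ g ∈ Polynomial.degreeLT k (2 * m + d - 1),
      ∑ j ∈ Finset.range m, (-c) ^ j * (q ^ (d - j) * s j) = q ^ (d - m + 1) * g := by
  refine ⟨∑ j ∈ Finset.range m, (-c) ^ j * (q ^ (m - 1 - j) * s j), sum_mem fun j hj => ?_, ?_⟩
  · have hj : j < m := Finset.mem_range.1 hj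
    rw [show 2 * m + d - 1 = 2 * m + d - 2 + 1 by lia, mem_degreeLT_succ]
    have hc : ((-c) ^ j).natDegree ≤ j * 3 :=
      Polynomial.natDegree_pow_le_of_le j (by rw [Polynomial.natDegree_neg, h.natDegree_right])
    have hq := Polynomial.natDegree_pow_le_of_le (m - 1 - j) h.natDegree_left_le
    have := Polynomial.natDegree_mul_le_of_le hc (Polynomial.natDegree_mul_le_of_le hq (hs j hj))
    lia
  · rw [Finset.mul_sum]
    refine Finset.sum_congr rfl fun j hj => ?_
    have hj : j < m := Finset.mem_range.1 hj
    rw [show d - j = d - m + 1 + (m - 1 - j) by lia, pow_add]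
    ring

theorem pullback_mem_curveForms {d : ℕ} {G : MvPolynomial (Fin 3) k} (hG : G.IsHomogeneous d) :
    pullback q c G ∈ curveForms q c d := by
  obtain ⟨g, hg, hsum⟩ := h.exists_sum_eq_pow_mul le_rfl fun j hj => natDegree_slice_le hG hj.le
  have hconst := Polynomial.eq_C_of_natDegree_le_zero
    ((natDegree_slice_le hG le_rfl).trans_eq (Nat.sub_self d))
  refine mem_curveForms.2 ⟨(slice G d).coeff 0, g, by convert hg using 2; lia, ?_⟩
  rw [pullback_eq_sum hG, Finset.sum_range_succ, hsum, ← hconst, Nat.sub_self, zero_add, pow_one,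
    pow_zero, one_mul, add_comm]

theorem curveForms_inf_degreeLT (d : ℕ) :
    curveForms q c d ⊓ Polynomial.degreeLT k (3 * d) = boundedMultiples q (3 * d - 1) := by
  refine le_antisymm ?_ (le_inf le_sup_right (h.boundedMultiples_left_le_degreeLT d))
  rintro f ⟨hf, hlt⟩
  obtain ⟨a, g, hg, rfl⟩ := mem_curveForms.1 hf
  have hqg : q * g ∈ boundedMultiples q (3 * d - 1) := ⟨g, hg, rfl⟩
  rw [SetLike.mem_coe, add_mem_cancel_right (h.boundedMultiples_left_le_degreeLT d hqg),
    h.neg_right_pow_mul_mem_degreeLT_self_iff] at hlt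
  rwa [hlt, mul_zero, zero_add]

theorem curveForms_le_degreeLT (d : ℕ) : curveForms q c d ≤ Polynomial.degreeLT k (3 * d + 1) := by
  refine sup_le ((Submodule.span_singleton_le_iff_mem _ _).2 ?_)
    ((h.boundedMultiples_left_le_degreeLT d).trans (Polynomial.degreeLT_mono (Nat.le_succ _)))
  rw [mem_degreeLT_succ, h.natDegree_neg_right_pow]

theorem finrank_curveForms (d : ℕ) :
    Module.finrank k (curveForms q c d) = 3 * d - 1 + 1 := by
  have hdisj : Disjoint (boundedMultiples q (3 * d - 1)) (k ∙ (-c) ^ d) := by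
    refine (Submodule.disjoint_span_singleton' (h.neg_right_pow_ne_zero d)).2 fun hmem => ?_
    have hlt := h.boundedMultiples_left_le_degreeLT d hmem
    rw [← mul_one ((-c) ^ d), h.neg_right_pow_mul_mem_degreeLT_self_iff] at hlt
    exact one_ne_zero hlt
  have hsum := Submodule.finrank_sup_add_finrank_inf_eq (boundedMultiples q (3 * d - 1))
    (k ∙ (-c) ^ d)
  rwa [hdisj.eq_bot, finrank_bot, finrank_span_singleton (h.neg_right_pow_ne_zero d),
    finrank_boundedMultiples h.left_ne_zero, sup_comm] at hsum

theorem exists_pullback_eq_pow_mul (m e : ℕ) {g : k[X]}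
    (hg : g ∈ Polynomial.degreeLT k (3 * m + (2 + e))) :
    ∃ G : MvPolynomial (Fin 3) k, G.IsHomogeneous (m + (e + 1)) ∧
      pullback q c G = q ^ (e + 1) * g := by
  induction m generalizing e g with
  | zero =>
    refine ⟨binaryForm (e + 1) g, ?_, pullback_binaryForm ?_⟩
    · rw [Nat.zero_add]
      exact binaryForm_isHomogeneous (e + 1) g
    · rw [← mem_degreeLT_succ]
      convert hg using 2
      lia
  | succ m ih =>
    rw [← h.natDegree_neg_right_pow,
      ← boundedMultiples_sup_of_isCoprime (h.isCoprime_neg_right_pow (m + 1)).symm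
      (h.neg_right_pow_ne_zero _) h.left_ne_zero (h.natDegree_left_le.trans one_le_two) e]
      at hg
    obtain ⟨_, hx, _, hy, rfl⟩ := Submodule.mem_sup.1 hg
    obtain ⟨s, hs, rfl⟩ := mem_boundedMultiples.1 hx
    obtain ⟨a, ha, rfl⟩ := mem_boundedMultiples.1 hy
    rw [h.natDegree_neg_right_pow] at ha
    obtain ⟨G, hG, hpull⟩ := ih (e + 1) (g := a) (by convert ha using 2; lia)
    refine ⟨X 0 ^ (m + 1) * binaryForm (e + 1) s + G, IsHomogeneous.add ?_ ?_, ?_⟩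
    · have hX := ((isHomogeneous_X k (0 : Fin 3)).pow (m + 1)).mul
        (binaryForm_isHomogeneous (e + 1) s)
      rwa [one_mul] at hX
    · convert hG using 1
      lia
    · rw [map_add, map_mul, map_pow, pullback_X_zero, pullback_binaryForm, hpull]
      · ring
      · rw [← mem_degreeLT_succ]
        convert hs using 2
        lia

theorem map_pullback_homogeneousSubmodule (d : ℕ) :
    (homogeneousSubmodule (Fin 3) k d).map (pullback q c).toLinearMap = curveForms q c d := by
  refine le_antisymm ?_ (sup_le ((Submodule.span_singleton_le_iff_mem _ _).2 ?_) ?_)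
  · rintro _ ⟨G, hG, rfl⟩
    exact h.pullback_mem_curveForms hG
  · refine ⟨X 0 ^ d, isHomogeneous_X_pow 0 d, ?_⟩
    rw [AlgHom.toLinearMap_apply, map_pow, pullback_X_zero]
  · rintro _ ⟨g, hg, rfl⟩
    rcases d with - | d
    · rw [mem_degreeLT_zero.1 hg, map_zero]
      exact zero_mem _
    · obtain ⟨G, hG, hpull⟩ := h.exists_pullback_eq_pow_mul d 0 hg
      exact ⟨G, hG, by rw [AlgHom.toLinearMap_apply, hpull, zero_add, pow_one]; rfl⟩

theorem slice_eq_zero_of_pullback_mem {d : ℕ} {G : MvPolynomial (Fin 3) k} (hG : G.IsHomogeneous d)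
    (hlt : pullback q c G ∈ Polynomial.degreeLT k (3 * d)) : slice G d = 0 := by
  obtain ⟨g, hg, hsum⟩ := h.exists_sum_eq_pow_mul le_rfl fun j hj => natDegree_slice_le hG hj.le
  have hqg : q * g ∈ Polynomial.degreeLT k (3 * d) :=
    h.boundedMultiples_left_le_degreeLT d ⟨g, by rwa [show 3 * d - 1 = 2 * d + d - 1 by lia], rfl⟩
  rwa [pullback_eq_sum hG, Finset.sum_range_succ, hsum, Nat.sub_self, zero_add, pow_one,
    pow_zero, one_mul, add_mem_cancel_left hqg, h.neg_right_pow_mul_mem_degreeLT_self_iff] at hlt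

theorem doubleAt_apexVec_iff_pullback_mem {d : ℕ} {G : MvPolynomial (Fin 3) k}
    (hG : G.IsHomogeneous (d + 1)) :
    DoubleAt ![1, 0, 0] G ↔ pullback q c G ∈ boundedMultiples (q ^ 2) (3 * d) := by
  obtain ⟨g, hg, hsum⟩ := h.exists_sum_eq_pow_mul (Nat.le_add_right d 1)
    fun j hj => natDegree_slice_le hG (hj.le.trans (Nat.le_add_right d 1))
  rw [show 2 * d + (d + 1) - 1 = 3 * d by lia] at hg
  have hpull : pullback q c G =
      q ^ 2 * g + (-c) ^ d * (q * slice G d) + (-c) ^ (d + 1) * slice G (d + 1) := by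
    rw [pullback_eq_sum hG, Finset.sum_range_succ, Finset.sum_range_succ, hsum]
    simp only [Nat.add_sub_cancel_left, Nat.sub_self, pow_zero, pow_one, one_mul,
      one_add_one_eq_two]
  rw [doubleAt_apexVec_iff hG, Nat.add_sub_cancel]
  constructor
  · rintro ⟨h₀, h₁⟩
    exact ⟨g, hg, by rw [hpull, h₀, h₁]; simp⟩
  · rintro hmem
    have h₀ : slice G (d + 1) = 0 := h.slice_eq_zero_of_pullback_mem hG
      (boundedMultiples_le_degreeLT (Polynomial.natDegree_pow_le_of_le 2 h.natDegree_left_le)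
        (by lia) hmem)
    obtain ⟨g', hg', heq⟩ := mem_boundedMultiples.1 hmem
    have hrel : (-c) ^ d * slice G d = q * (g' - g) := by
      refine mul_left_cancel₀ h.left_ne_zero ?_
      linear_combination -hpull - heq - (-c) ^ (d + 1) * h₀
    obtain ⟨r, hr⟩ := (h.isCoprime_neg_right_pow d).dvd_of_dvd_mul_left (Dvd.intro _ hrel.symm)
    have hr0 : r = 0 := by
      rw [← h.neg_right_pow_mul_mem_degreeLT_self_iff (j := d)]
      convert sub_mem hg' hg using 1
      refine mul_left_cancel₀ h.left_ne_zero ?_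
      rw [← hrel, hr]
      ring
    exact ⟨h₀, by rw [hr, hr0, mul_zero]⟩

end IsNormalPair

/-! ### The kernel of the pullback -/

section Kernel

variable {k : Type*} [Field k] {q c : k[X]}

theorem cubicForm_dvd_binaryForm_pow_mul_sub (hq : q.natDegree ≤ 2) (hc : c.natDegree ≤ 3) {d : ℕ}
    {G : MvPolynomial (Fin 3) k} (hG : G.IsHomogeneous d) :
    cubicForm q c ∣ binaryForm 2 q ^ d * G - binaryForm (3 * d) (pullback q c G) := by
  have hterm {j : ℕ} (hj : j ≤ d) :
      binaryForm (3 * d) ((-c) ^ j * (q ^ (d - j) * slice G j)) =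
        binaryForm 3 (-c) ^ j * (binaryForm 2 q ^ (d - j) * binaryForm (d - j) (slice G j)) := by
    have hc' : (-c).natDegree ≤ 3 := by rwa [Polynomial.natDegree_neg]
    have hs := natDegree_slice_le hG hj
    have hqp := Polynomial.natDegree_pow_le_of_le (d - j) hq
    have hcp := Polynomial.natDegree_pow_le_of_le j hc'
    rw [← binaryForm_pow hc', ← binaryForm_pow hq, mul_comm 2, mul_comm 3 j,
      ← binaryForm_mul hqp hs, ← binaryForm_mul hcp (Polynomial.natDegree_mul_le_of_le hqp hs)]
    congr 2
    lia
  have hsub : binaryForm 2 q * X 0 - binaryForm 3 (-c) = cubicForm q c := by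
    rw [map_neg, sub_neg_eq_add, cubicForm, mul_comm]
  have hG' : binaryForm 2 q ^ d * G = ∑ j ∈ Finset.range (d + 1),
      binaryForm 2 q ^ d * (X 0 ^ j * binaryForm (d - j) (slice G j)) := by
    conv_lhs => rw [eq_sum_slice hG, Finset.mul_sum]
  rw [hG', pullback_eq_sum hG, map_sum, ← Finset.sum_sub_distrib]
  refine Finset.dvd_sum fun j hj => ?_
  have hj : j ≤ d := Nat.lt_succ_iff.1 (Finset.mem_range.1 hj)
  rw [hterm hj, ← hsub]
  refine ((sub_dvd_pow_sub_pow (binaryForm 2 q * X 0) (binaryForm 3 (-c)) j).mul_right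
    (binaryForm 2 q ^ (d - j) * binaryForm (d - j) (slice G j))).trans (dvd_of_eq ?_)
  rw [← pow_mul_pow_sub (binaryForm 2 q) hj]
  ring

theorem exists_isHomogeneous_eq_mul_of_dvd {σ : Type*} {m d : ℕ} {F G : MvPolynomial σ k}
    (hF : F.IsHomogeneous m) (hG : G.IsHomogeneous (m + d)) (hFG : F ∣ G) :
    ∃ A : MvPolynomial σ k, A.IsHomogeneous d ∧ G = F * A := by
  obtain ⟨A, rfl⟩ := hFG
  let _ : GradedAlgebra (homogeneousSubmodule σ k) := gradedAlgebra
  refine ⟨DirectSum.decompose (homogeneousSubmodule σ k) A d,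
    (mem_homogeneousSubmodule d _).1 (SetLike.coe_mem _), ?_⟩
  rw [← DirectSum.coe_decompose_mul_add_of_left_mem (homogeneousSubmodule σ k)
      ((mem_homogeneousSubmodule m F).2 hF),
    DirectSum.decompose_of_mem_same _ ((mem_homogeneousSubmodule (m + d) (F * A)).2 hG)]

end Kernel

namespace IsNormalPair

variable {k : Type*} [Field k] {q c : k[X]} (h : IsNormalPair q c)
include h

theorem cubicForm_dvd_of_pullback_eq_zero (hirr : Irreducible (cubicForm q c)) {d : ℕ}
    {G : MvPolynomial (Fin 3) k} (hG : G.IsHomogeneous d) (hpull : pullback q c G = 0) :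
    cubicForm q c ∣ G := by
  have hdvd := cubicForm_dvd_binaryForm_pow_mul_sub (h.natDegree_left_le.trans one_le_two)
    h.natDegree_right.le hG
  rw [hpull, map_zero, sub_zero] at hdvd
  refine (hirr.prime.dvd_or_dvd hdvd).resolve_left fun hpow => ?_
  have hne : binaryForm 2 q ≠ 0 := fun h0 => by
    have := pullback_binaryForm (q := q) (c := c) (h.natDegree_left_le.trans one_le_two)
    rw [h0, map_zero] at this
    exact mul_ne_zero (pow_ne_zero 2 h.left_ne_zero) h.left_ne_zero this.symm
  have hle := totalDegree_le_of_dvd_of_isDomain (hirr.prime.dvd_of_dvd_pow hpow) hne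
  rw [(cubicForm_isHomogeneous q c).totalDegree hirr.ne_zero,
    (binaryForm_isHomogeneous 2 q).totalDegree hne] at hle
  exact absurd hle (by decide)

theorem pullback_eq_zero_iff (hirr : Irreducible (cubicForm q c)) {d : ℕ}
    {G : MvPolynomial (Fin 3) k} (hG : G.IsHomogeneous (d + 3)) :
    pullback q c G = 0 ↔
      ∃ A : MvPolynomial (Fin 3) k, A.IsHomogeneous d ∧ cubicForm q c * A = G := by
  constructor
  · intro hpull
    obtain ⟨A, hA, rfl⟩ := exists_isHomogeneous_eq_mul_of_dvd (cubicForm_isHomogeneous q c)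
      (by rwa [add_comm]) (h.cubicForm_dvd_of_pullback_eq_zero hirr hG hpull)
    exact ⟨A, hA, rfl⟩
  · rintro ⟨A, -, rfl⟩
    rw [map_mul, pullback_cubicForm (h.natDegree_left_le.trans one_le_two) h.natDegree_right.le,
      zero_mul]

theorem eq_zero_of_pullback_eq_zero (hirr : Irreducible (cubicForm q c)) {d : ℕ} (hd : d < 3)
    {G : MvPolynomial (Fin 3) k} (hG : G.IsHomogeneous d) (hpull : pullback q c G = 0) : G = 0 := by
  by_contra hne
  have hle := totalDegree_le_of_dvd_of_isDomain
    (h.cubicForm_dvd_of_pullback_eq_zero hirr hG hpull) hne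
  rw [(cubicForm_isHomogeneous q c).totalDegree hirr.ne_zero, hG.totalDegree hne] at hle
  lia

end IsNormalPair

/-! ### Points of the curve -/

section CurveVec

variable {k : Type*} [Field k] {q c : k[X]}

theorem X_sub_C_sq_dvd_iff {u : k} {f : k[X]} : (Polynomial.X - Polynomial.C u) ^ 2 ∣ f ↔
    f.eval u = 0 ∧ f.derivative.eval u = 0 := by
  rcases eq_or_ne f 0 with rfl | hf
  · simp
  · rw [← Polynomial.le_rootMultiplicity_iff hf]
    exact Polynomial.one_lt_rootMultiplicity_iff_isRoot hf

theorem derivative_pullback_eval (u : k) (G : MvPolynomial (Fin 3) k) :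
    (pullback q c G).derivative.eval u =
      eval (curveVec q c u) (pderiv 1 G) * (q.eval u + u * q.derivative.eval u) +
        eval (curveVec q c u) (pderiv 2 G) * q.derivative.eval u -
        eval (curveVec q c u) (pderiv 0 G) * c.derivative.eval u := by
  have hderiv := congrArg (Polynomial.eval u) (derivative_aeval ![-c, Polynomial.X * q, q] G)
  rw [← pullback] at hderiv
  rw [hderiv, Fin.sum_univ_three]
  simp only [Polynomial.eval_add, Polynomial.eval_mul, eval_pullback,
    Matrix.cons_val_zero, Matrix.cons_val_one, Matrix.cons_val, Polynomial.derivative_mul,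
    Polynomial.derivative_neg, Polynomial.derivative_X, Polynomial.eval_neg, Polynomial.eval_X,
    one_mul]
  ring

theorem doubleAt_curveVec_iff {d : ℕ} {G : MvPolynomial (Fin 3) k} (hG : G.IsHomogeneous d)
    {u : k} (hu : q.eval u ≠ 0) : DoubleAt (curveVec q c u) G ↔
      (Polynomial.X - Polynomial.C u) ^ 2 ∣ pullback q c G ∧
        eval (curveVec q c u) (pderiv 0 G) = 0 := by
  have heuler := congrArg (eval (curveVec q c u)) hG.sum_X_mul_pderiv
  rw [X_sub_C_sq_dvd_iff, eval_pullback, derivative_pullback_eval]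
  simp only [Fin.sum_univ_three, map_add, map_mul, map_nsmul, eval_X] at heuler
  constructor
  · rintro ⟨h₀, h₁⟩
    simp only [h₀, h₁, zero_mul, add_zero, sub_zero, and_self]
  · rintro ⟨⟨h₀, hderiv⟩, hX⟩
    rw [h₀, hX, smul_zero] at heuler
    rw [hX, zero_mul, sub_zero] at hderiv
    rw [curveVec_one, curveVec_two, mul_zero, zero_add] at heuler
    have h₁ : eval (curveVec q c u) (pderiv 1 G) = 0 := by
      refine (mul_eq_zero.1 (?_ : q.eval u ^ 2 * _ = 0)).resolve_left (pow_ne_zero 2 hu)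
      linear_combination q.eval u * hderiv - q.derivative.eval u * heuler
    have h₂ : eval (curveVec q c u) (pderiv 2 G) = 0 := by
      refine (mul_eq_zero.1 (?_ : q.eval u * _ = 0)).resolve_left hu
      linear_combination heuler - u * q.eval u * h₁
    exact ⟨h₀, Fin.forall_fin_succ.2 ⟨hX, Fin.forall_fin_two.2 ⟨h₁, h₂⟩⟩⟩

end CurveVec

section Nodal

open Lagrange

variable {k : Type*} [Field k]

theorem nodal_pow_dvd_iff {U : Finset k} {f : k[X]} (j : ℕ) :
    nodal U id ^ j ∣ f ↔ ∀ u ∈ U, (Polynomial.X - Polynomial.C u) ^ j ∣ f := by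
  refine ⟨fun h u hu => (pow_dvd_pow_of_dvd (X_sub_C_dvd_nodal id hu) j).trans h, fun h => ?_⟩
  rw [nodal_eq, ← Finset.prod_pow]
  exact Finset.prod_dvd_of_coprime
    (fun u _ v _ huv =>
      (Polynomial.isCoprime_X_sub_C_of_isUnit_sub (sub_ne_zero.2 huv).isUnit).pow) h

theorem isCoprime_nodal {U : Finset k} {q : k[X]} (hU : ∀ u ∈ U, q.eval u ≠ 0) :
    IsCoprime q (nodal U id) :=
  IsCoprime.prod_right fun u hu =>
    ((Polynomial.irreducible_X_sub_C u).coprime_iff_not_dvd.2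
      (mt Polynomial.dvd_iff_isRoot.1 (hU u hu))).symm

end Nodal

section PointIdeal

variable {k : Type*} [Field k]

theorem mem_pointIdeal_mk_iff {d : ℕ} {G : MvPolynomial (Fin 3) k} (hG : G.IsHomogeneous d)
    {v : Fin 3 → k} (hv : v ≠ 0) : G ∈ pointIdeal (Projectivization.mk k v hv) ↔ eval v G = 0 := by
  rw [← vanishesAt_mk hG hv]
  exact ⟨eval_rep_of_mem_pointIdeal, fun h => Ideal.subset_span ⟨d, hG, h⟩⟩

end PointIdeal

namespace IsNormalPair

open Lagrange

variable {k : Type*} [Field k] {q c : k[X]} (h : IsNormalPair q c)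

section

include h

theorem curveVec_ne_zero (u : k) : curveVec q c u ≠ 0 := by
  intro h0
  obtain ⟨a, b, hab⟩ := h.isCoprime
  have hq : q.eval u = 0 := congr_fun h0 2
  have hc : c.eval u = 0 := neg_eq_zero.1 (congr_fun h0 0)
  simpa [hq, hc] using congrArg (Polynomial.eval u) hab

end

/-- The point with parameter `u` on the cubic `x₀ q + c = 0`; it is a smooth point of the cubic
if `q u ≠ 0`, and the singular point otherwise. -/
noncomputable def curvePoint (u : k) : Plane k :=
  Projectivization.mk k (curveVec q c u) (h.curveVec_ne_zero u)

theorem curvePoint_ne_apex {u : k} (hu : q.eval u ≠ 0) : h.curvePoint u ≠ apex := by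
  intro heq
  obtain ⟨a, ha⟩ := (Projectivization.mk_eq_mk_iff' k _ _ _ _).1 heq
  exact hu (by simpa [curveVec] using (congr_fun ha 2).symm)

theorem injOn_curvePoint : Set.InjOn h.curvePoint {u | q.eval u ≠ 0} := by
  intro u hu v _ heq
  obtain ⟨a, ha⟩ := (Projectivization.mk_eq_mk_iff' k _ _ _ _).1 heq
  have h₁ : a * (v * q.eval v) = u * q.eval u := congr_fun ha 1
  have h₂ : a * q.eval v = q.eval u := congr_fun ha 2
  refine mul_right_cancel₀ hu ?_
  linear_combination v * h₂ - h₁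

open Classical in
/-- The set of points with parameters in `U` on the cubic `x₀ q + c = 0`. -/
noncomputable def curvePoints (U : Finset k) : Finset (Plane k) :=
  U.image h.curvePoint

open Classical in
/-- The set of points with parameters in `U` on the cubic `x₀ q + c = 0`, together with its
singular point. -/
noncomputable def curvePointsWithApex (U : Finset k) : Finset (Plane k) :=
  insert apex (h.curvePoints U)

variable {U : Finset k}

theorem card_curvePointsWithApex (hU : ∀ u ∈ U, q.eval u ≠ 0) :
    (h.curvePointsWithApex U).card = U.card + 1 := by
  classical
  rw [curvePointsWithApex, Finset.card_insert_of_notMem, curvePoints,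
    Finset.card_image_of_injOn (h.injOn_curvePoint.mono hU)]
  intro hmem
  obtain ⟨u, hu, heq⟩ := Finset.mem_image.1 hmem
  exact h.curvePoint_ne_apex (hU u hu) heq

theorem mem_fatIdeal_one_curvePoints_iff {d : ℕ} {G : MvPolynomial (Fin 3) k}
    (hG : G.IsHomogeneous d) :
    G ∈ fatIdeal 1 (h.curvePoints U) ↔ ∀ u ∈ U, eval (curveVec q c u) G = 0 := by
  classical
  simp only [mem_fatIdeal, curvePoints, Finset.forall_mem_image, pow_one, curvePoint,
    mem_pointIdeal_mk_iff hG]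

theorem mem_fatIdeal_one_curvePoints_iff_dvd {d : ℕ} {G : MvPolynomial (Fin 3) k}
    (hG : G.IsHomogeneous d) :
    G ∈ fatIdeal 1 (h.curvePoints U) ↔ nodal U id ∣ pullback q c G := by
  rw [h.mem_fatIdeal_one_curvePoints_iff hG, ← pow_one (nodal U id), nodal_pow_dvd_iff]
  simp only [pow_one, Polynomial.dvd_iff_isRoot, Polynomial.IsRoot.def, eval_pullback]

theorem mem_fatIdeal_two_curvePointsWithApex_iff {d : ℕ} {G : MvPolynomial (Fin 3) k}
    (hG : G.IsHomogeneous d) (hU : ∀ u ∈ U, q.eval u ≠ 0) :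
    G ∈ fatIdeal 2 (h.curvePointsWithApex U) ↔ DoubleAt ![1, 0, 0] G ∧
      nodal U id ^ 2 ∣ pullback q c G ∧ ∀ u ∈ U, eval (curveVec q c u) (pderiv 0 G) = 0 := by
  classical
  rw [nodal_pow_dvd_iff, mem_fatIdeal, curvePointsWithApex, Finset.forall_mem_insert, apex,
    mem_pointIdeal_mk_sq_iff hG, curvePoints, Finset.forall_mem_image, ← forall₂_and]
  refine and_congr_right' (forall₂_congr fun u hu => ?_)
  rw [curvePoint, mem_pointIdeal_mk_sq_iff hG, doubleAt_curveVec_iff hG (hU u hu)]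

theorem mem_fatIdeal_two_curvePointsWithApex_iff_mem_boundedMultiples {d : ℕ}
    {G : MvPolynomial (Fin 3) k} (hG : G.IsHomogeneous (d + 1)) (hU : ∀ u ∈ U, q.eval u ≠ 0) :
    G ∈ fatIdeal 2 (h.curvePointsWithApex U) ↔
      pullback q c G ∈ boundedMultiples (q ^ 2 * nodal U id ^ 2) (3 * d - 2 * U.card) ∧
        ∀ u ∈ U, eval (curveVec q c u) (pderiv 0 G) = 0 := by
  have hS : (nodal U id ^ 2).natDegree = 2 * U.card := by
    rw [Polynomial.natDegree_pow, natDegree_nodal]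
  rw [h.mem_fatIdeal_two_curvePointsWithApex_iff hG hU, h.doubleAt_apexVec_iff_pullback_mem hG,
    ← and_assoc, ← hS, mem_boundedMultiples_mul_iff (isCoprime_nodal hU).pow
      (pow_ne_zero 2 h.left_ne_zero) (pow_ne_zero 2 nodal_ne_zero)]

include h in
theorem eval_pderiv_zero_cubicForm_mul (u : k) (A : MvPolynomial (Fin 3) k) :
    eval (curveVec q c u) (pderiv 0 (cubicForm q c * A)) =
      q.eval u ^ 3 * eval (curveVec q c u) A := by
  have hq := h.natDegree_left_le.trans one_le_two
  have hderiv : pderiv 0 (cubicForm q c) = binaryForm 2 q := by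
    rw [cubicForm, map_add, pderiv_mul, pderiv_zero_binaryForm, pderiv_zero_binaryForm,
      pderiv_X_self, mul_zero, add_zero, add_zero, one_mul]
  rw [pderiv_mul, map_add, map_mul, map_mul, hderiv, ← eval_pullback,
    ← eval_pullback _ (cubicForm q c), pullback_binaryForm hq,
    pullback_cubicForm hq h.natDegree_right.le, Polynomial.eval_zero,
    zero_mul, add_zero, Polynomial.eval_mul, Polynomial.eval_pow, ← pow_succ]

end IsNormalPair

/-! ### The residual sequence -/

section LinearAlgebra

variable {k V W : Type*} [Field k] [AddCommGroup V] [Module k V] [AddCommGroup W] [Module k W]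

theorem finrank_map_add_finrank_inf_ker (f : V →ₗ[k] W) (p : Submodule k V) [Module.Finite k p] :
    Module.finrank k (p.map f) + Module.finrank k (p ⊓ f.ker : Submodule k V) =
      Module.finrank k p := by
  rw [← (f.domRestrict p).finrank_range_add_finrank_ker, LinearMap.range_domRestrict,
    ← p.map_comap_subtype, p.finrank_map_subtype_eq]
  rfl

end LinearAlgebra

namespace IsNormalPair

open Lagrange

variable {k : Type*} [Field k] {q c : k[X]} (h : IsNormalPair q c)

section Ideal

include h

theorem hilbertFn_add_finrank_map_pullback (I : Ideal (MvPolynomial (Fin 3) k)) (d : ℕ) :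
    hilbertFn I d + Module.finrank k ((degreePart I d).map (pullback q c).toLinearMap) +
        Module.finrank k
          (degreePart I d ⊓ (pullback q c).toLinearMap.ker : Submodule k (MvPolynomial (Fin 3) k)) =
      3 * d - 1 + 1 + Module.finrank k
        (homogeneousSubmodule (Fin 3) k d ⊓ (pullback q c).toLinearMap.ker :
          Submodule k (MvPolynomial (Fin 3) k)) := by
  rw [add_assoc, finrank_map_add_finrank_inf_ker, hilbertFn_add_finrank_degreePart,
    ← finrank_map_add_finrank_inf_ker (pullback q c).toLinearMap,
    h.map_pullback_homogeneousSubmodule, h.finrank_curveForms]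

end Ideal

variable {U : Finset k}

theorem map_pullback_degreePart_curvePoints (d : ℕ) :
    (degreePart (fatIdeal 1 (h.curvePoints U)) d).map (pullback q c).toLinearMap =
      curveForms q c d ⊓ boundedMultiples (nodal U id) (3 * d + 1 - U.card) := by
  ext f
  rw [← natDegree_nodal (s := U) (v := id), Submodule.mem_inf,
    mem_boundedMultiples_sub_natDegree nodal_ne_zero, Submodule.mem_map]
  constructor
  · rintro ⟨G, hG, rfl⟩
    obtain ⟨hG, hmem⟩ := mem_degreePart.1 hG
    exact ⟨h.pullback_mem_curveForms hG, (h.mem_fatIdeal_one_curvePoints_iff_dvd hG).1 hmem,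
      h.curveForms_le_degreeLT d (h.pullback_mem_curveForms hG)⟩
  · rintro ⟨hf, hdvd, -⟩
    rw [← h.map_pullback_homogeneousSubmodule] at hf
    obtain ⟨G, hG, rfl⟩ := hf
    exact ⟨G, mem_degreePart.2 ⟨hG, (h.mem_fatIdeal_one_curvePoints_iff_dvd hG).2 hdvd⟩, rfl⟩

theorem hilbertFn_curvePoints_add (d : ℕ) :
    hilbertFn (fatIdeal 1 (h.curvePoints U)) d + Module.finrank k
        (curveForms q c d ⊓ boundedMultiples (nodal U id) (3 * d + 1 - U.card) : Submodule k k[X]) =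
      3 * d - 1 + 1 := by
  have hker : degreePart (fatIdeal 1 (h.curvePoints U)) d ⊓ (pullback q c).toLinearMap.ker =
      homogeneousSubmodule (Fin 3) k d ⊓ (pullback q c).toLinearMap.ker := by
    ext G
    refine and_congr_left fun hpull => ?_
    rw [SetLike.mem_coe, mem_degreePart]
    refine and_iff_left_of_imp fun hG => (h.mem_fatIdeal_one_curvePoints_iff_dvd hG).2 ?_
    rw [show pullback q c G = 0 from hpull]
    exact dvd_zero _
  have hsum := h.hilbertFn_add_finrank_map_pullback (fatIdeal 1 (h.curvePoints U)) d
  rwa [hker, add_left_inj, h.map_pullback_degreePart_curvePoints] at hsum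

theorem hilbertFn_curvePoints_of_lt {d : ℕ} (hd : 3 * d < U.card) :
    hilbertFn (fatIdeal 1 (h.curvePoints U)) d = 3 * d - 1 + 1 := by
  have hsum := h.hilbertFn_curvePoints_add (U := U) d
  have hbot : boundedMultiples (nodal U id) (3 * d + 1 - U.card) = ⊥ := by
    rw [← Submodule.finrank_eq_zero (R := k), finrank_boundedMultiples nodal_ne_zero]
    lia
  rwa [hbot, inf_bot_eq, finrank_bot, add_zero] at hsum

theorem hilbertFn_curvePoints_of_mem {d : ℕ} (hd : 3 * d = U.card)
    (hS : nodal U id ∈ curveForms q c d) :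
    hilbertFn (fatIdeal 1 (h.curvePoints U)) d = 3 * d - 1 := by
  have hsum := h.hilbertFn_curvePoints_add (U := U) d
  rw [hd, Nat.add_sub_cancel_left, boundedMultiples_one,
    inf_eq_right.2 ((Submodule.span_singleton_le_iff_mem _ _).2 hS),
    finrank_span_singleton nodal_ne_zero] at hsum
  lia

theorem hilbertFn_curvePoints_of_notMem {d : ℕ} (hd : 3 * d = U.card)
    (hS : nodal U id ∉ curveForms q c d) :
    hilbertFn (fatIdeal 1 (h.curvePoints U)) d = 3 * d - 1 + 1 := by
  have hsum := h.hilbertFn_curvePoints_add (U := U) d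
  rwa [hd, Nat.add_sub_cancel_left, boundedMultiples_one,
    ((Submodule.disjoint_span_singleton' nodal_ne_zero).2 hS).eq_bot, finrank_bot, add_zero, ← hd]
    at hsum

include h in
theorem not_boundedMultiples_nodal_le_curveForms (hU : ∀ u ∈ U, q.eval u ≠ 0) {d : ℕ}
    (hd : U.card < 3 * d) :
    ¬ boundedMultiples (nodal U id) (3 * d + 1 - U.card) ≤ curveForms q c d := by
  intro hle
  have hmul : ∀ j < 3 * d - U.card, ∃ g ∈ Polynomial.degreeLT k (3 * d - 1),
      q * g = nodal U id * Polynomial.X ^ j := by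
    intro j hj
    have hdeg : (nodal U id * (Polynomial.X : k[X]) ^ j).natDegree = U.card + j := by
      rw [Polynomial.natDegree_mul_X_pow j nodal_ne_zero, natDegree_nodal]
    rw [← mem_boundedMultiples, ← h.curveForms_inf_degreeLT]
    refine ⟨hle ⟨Polynomial.X ^ j, ?_, rfl⟩, ?_⟩
    · exact Polynomial.mem_degreeLT.2 ((Polynomial.degree_X_pow_le j).trans_lt (by norm_cast; lia))
    · rw [show 3 * d = 3 * d - 1 + 1 by lia, SetLike.mem_coe, mem_degreeLT_succ, hdeg]
      lia
  have hq : IsUnit q := by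
    obtain ⟨g, -, hg⟩ := hmul 0 (by lia)
    rw [pow_zero, mul_one] at hg
    exact (isCoprime_nodal hU).isUnit_of_dvd' dvd_rfl (Dvd.intro g hg)
  obtain ⟨g, hg, heq⟩ := hmul (3 * d - U.card - 1) (by lia)
  have hg0 : g ≠ 0 := by
    rintro rfl
    exact mul_ne_zero nodal_ne_zero (pow_ne_zero _ Polynomial.X_ne_zero) (by rw [← heq, mul_zero])
  have hdeg := congrArg Polynomial.natDegree heq
  rw [Polynomial.natDegree_mul_X_pow _ nodal_ne_zero, natDegree_nodal,
    Polynomial.natDegree_mul h.left_ne_zero hg0, Polynomial.natDegree_eq_zero_of_isUnit hq] at hdeg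
  have := natDegree_lt_of_mem_degreeLT hg hg0
  lia

theorem hilbertFn_curvePoints_of_gt (hU : ∀ u ∈ U, q.eval u ≠ 0) {d : ℕ} (hd : U.card < 3 * d) :
    hilbertFn (fatIdeal 1 (h.curvePoints U)) d = U.card := by
  have hsum := h.hilbertFn_curvePoints_add (U := U) d
  have hsup := Submodule.finrank_sup_add_finrank_inf_eq (curveForms q c d)
    (boundedMultiples (nodal U id) (3 * d + 1 - U.card))
  have hlt := Submodule.finrank_lt_finrank_of_lt
    (left_lt_sup.2 (h.not_boundedMultiples_nodal_le_curveForms hU hd))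
  have hle := Submodule.finrank_mono (sup_le (h.curveForms_le_degreeLT d)
    (boundedMultiples_le_degreeLT (natDegree_nodal (s := U) (v := id)).le
      (by lia : U.card + (3 * d + 1 - U.card) ≤ 3 * d + 1)))
  rw [h.finrank_curveForms, finrank_boundedMultiples nodal_ne_zero] at hsup
  rw [finrank_degreeLT] at hle
  rw [h.finrank_curveForms] at hlt
  lia

end IsNormalPair

namespace IsNormalPair

open Lagrange

variable {k : Type*} [Field k] {q c : k[X]} (h : IsNormalPair q c) {U : Finset k}

theorem exists_interpolation_of_hilbertFn_eq {d : ℕ}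
    (hd : hilbertFn (fatIdeal 1 (h.curvePoints U)) d = U.card) (w : k → k) :
    ∃ A : MvPolynomial (Fin 3) k, A.IsHomogeneous d ∧ ∀ u ∈ U, eval (curveVec q c u) A = w u := by
  let E : MvPolynomial (Fin 3) k →ₗ[k] U → k :=
    LinearMap.pi fun u => (aeval (curveVec q c u.1)).toLinearMap
  have hker : homogeneousSubmodule (Fin 3) k d ⊓ E.ker =
      degreePart (fatIdeal 1 (h.curvePoints U)) d := by
    ext G
    rw [mem_degreePart]
    refine and_congr_right fun hG => ?_
    rw [h.mem_fatIdeal_one_curvePoints_iff hG]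
    simp only [E, SetLike.mem_coe, LinearMap.mem_ker, funext_iff, LinearMap.pi_apply,
      AlgHom.toLinearMap_apply, aeval_eq_eval, Pi.zero_apply, Subtype.forall]
  have hsum := finrank_map_add_finrank_inf_ker E (homogeneousSubmodule (Fin 3) k d)
  rw [hker, ← hilbertFn_add_finrank_degreePart, add_left_inj, hd] at hsum
  have htop : (homogeneousSubmodule (Fin 3) k d).map E = ⊤ :=
    Submodule.eq_top_of_finrank_eq
      (by rw [hsum, Module.finrank_fintype_fun_eq_card, Fintype.card_coe])
  obtain ⟨A, hA, hEA⟩ := (htop ▸ Submodule.mem_top : (fun u : U => w u) ∈ _)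
  exact ⟨A, hA, fun u hu => by simpa [E, aeval_eq_eval] using congr_fun hEA ⟨u, hu⟩⟩

theorem cubicForm_mul_mem_fatIdeal_two_iff {d : ℕ} {A : MvPolynomial (Fin 3) k}
    (hA : A.IsHomogeneous d) (hU : ∀ u ∈ U, q.eval u ≠ 0) :
    cubicForm q c * A ∈ fatIdeal 2 (h.curvePointsWithApex U) ↔
      A ∈ fatIdeal 1 (h.curvePoints U) := by
  have hFA : (cubicForm q c * A).IsHomogeneous (d + 2 + 1) := by
    rw [show d + 2 + 1 = 3 + d by lia]
    exact (cubicForm_isHomogeneous q c).mul hA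
  rw [h.mem_fatIdeal_two_curvePointsWithApex_iff_mem_boundedMultiples hFA hU, map_mul,
    pullback_cubicForm (h.natDegree_left_le.trans one_le_two) h.natDegree_right.le, zero_mul,
    and_iff_right (zero_mem _), h.mem_fatIdeal_one_curvePoints_iff hA]
  refine forall₂_congr fun u hu => ?_
  rw [h.eval_pderiv_zero_cubicForm_mul, mul_eq_zero, or_iff_right (pow_ne_zero 3 (hU u hu))]

theorem map_pullback_degreePart_curvePointsWithApex (hU : ∀ u ∈ U, q.eval u ≠ 0)
    (hcard : 6 ≤ U.card) (d : ℕ) :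
    (degreePart (fatIdeal 2 (h.curvePointsWithApex U)) (d + 3)).map (pullback q c).toLinearMap =
      boundedMultiples (q ^ 2 * nodal U id ^ 2) (3 * (d + 2) - 2 * U.card) := by
  refine le_antisymm ?_ ?_
  · rintro _ ⟨G, hG, rfl⟩
    obtain ⟨hG, hmem⟩ := mem_degreePart.1 hG
    exact ((h.mem_fatIdeal_two_curvePointsWithApex_iff_mem_boundedMultiples hG hU).1 hmem).1
  rcases le_or_gt (3 * (d + 2)) (2 * U.card) with hle | hlt
  · rw [Nat.sub_eq_zero_of_le hle]
    rintro _ ⟨g, hg, rfl⟩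
    rw [mem_degreeLT_zero.1 hg, map_zero]
    exact zero_mem _
  rintro f hf
  have hcurve : f ∈ curveForms q c (d + 3) := by
    obtain ⟨g, hg, rfl⟩ := mem_boundedMultiples.1 hf
    refine boundedMultiples_le_curveForms q c (d + 3) ⟨q * nodal U id ^ 2 * g, ?_, ?_⟩
    · refine mul_mem_degreeLT (Polynomial.natDegree_mul_le_of_le h.natDegree_left_le
        (Polynomial.natDegree_pow_le_of_le 2 natDegree_nodal.le)) hg ?_
      lia
    · rw [LinearMap.mulLeft_apply]
      ring
  rw [← h.map_pullback_homogeneousSubmodule] at hcurve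
  obtain ⟨G, hG, rfl⟩ := hcurve
  -- Adding a multiple of the cubic to `G` changes neither the pullback nor the double point at the
  -- apex, and makes the derivative transverse to the curve vanish at the points of `U`.
  obtain ⟨A, hA, hval⟩ := h.exists_interpolation_of_hilbertFn_eq
    (h.hilbertFn_curvePoints_of_gt hU (by lia : U.card < 3 * d))
    fun u => -eval (curveVec q c u) (pderiv 0 G) / q.eval u ^ 3
  have hFA : (cubicForm q c * A).IsHomogeneous (d + 3) := by
    rw [add_comm]
    exact (cubicForm_isHomogeneous q c).mul hA
  have hpull : pullback q c (G + cubicForm q c * A) = pullback q c G := by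
    rw [map_add, map_mul, pullback_cubicForm (h.natDegree_left_le.trans one_le_two)
      h.natDegree_right.le, zero_mul, add_zero]
  refine ⟨G + cubicForm q c * A, mem_degreePart.2 ⟨hG.add hFA,
    (h.mem_fatIdeal_two_curvePointsWithApex_iff_mem_boundedMultiples (hG.add hFA) hU).2
      ⟨by rwa [hpull], fun u hu => ?_⟩⟩, hpull⟩
  rw [map_add, map_add, h.eval_pderiv_zero_cubicForm_mul, hval u hu,
    mul_div_cancel₀ _ (pow_ne_zero 3 (hU u hu)), add_neg_cancel]

include h in
theorem homogeneousSubmodule_inf_ker_pullback (hirr : Irreducible (cubicForm q c)) (d : ℕ) :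
    homogeneousSubmodule (Fin 3) k (d + 3) ⊓ (pullback q c).toLinearMap.ker =
      (homogeneousSubmodule (Fin 3) k d).map (LinearMap.mulLeft k (cubicForm q c)) := by
  ext G
  constructor
  · rintro ⟨hG, hpull⟩
    exact (h.pullback_eq_zero_iff hirr hG).1 hpull
  · rintro ⟨A, hA, rfl⟩
    have hFA : (cubicForm q c * A).IsHomogeneous (d + 3) := by
      rw [add_comm]
      exact (cubicForm_isHomogeneous q c).mul hA
    exact ⟨hFA, (h.pullback_eq_zero_iff hirr hFA).2 ⟨A, hA, rfl⟩⟩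

theorem degreePart_curvePointsWithApex_inf_ker_pullback (hirr : Irreducible (cubicForm q c))
    (hU : ∀ u ∈ U, q.eval u ≠ 0) (d : ℕ) :
    degreePart (fatIdeal 2 (h.curvePointsWithApex U)) (d + 3) ⊓ (pullback q c).toLinearMap.ker =
      (degreePart (fatIdeal 1 (h.curvePoints U)) d).map
        (LinearMap.mulLeft k (cubicForm q c)) := by
  rw [degreePart, inf_right_comm, h.homogeneousSubmodule_inf_ker_pullback hirr]
  ext G
  constructor
  · rintro ⟨⟨A, hA, rfl⟩, hmem⟩
    exact ⟨A, mem_degreePart.2 ⟨hA, (h.cubicForm_mul_mem_fatIdeal_two_iff hA hU).1 hmem⟩, rfl⟩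
  · rintro ⟨A, hA, rfl⟩
    obtain ⟨hA, hmem⟩ := mem_degreePart.1 hA
    exact ⟨⟨A, hA, rfl⟩, (h.cubicForm_mul_mem_fatIdeal_two_iff hA hU).2 hmem⟩

theorem hilbertFn_curvePointsWithApex_add_three (hirr : Irreducible (cubicForm q c))
    (hU : ∀ u ∈ U, q.eval u ≠ 0) (hcard : 6 ≤ U.card) (d : ℕ) :
    hilbertFn (fatIdeal 2 (h.curvePointsWithApex U)) (d + 3) + (3 * (d + 2) - 2 * U.card) =
      hilbertFn (fatIdeal 1 (h.curvePoints U)) d + 3 * (d + 3) := by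
  have hinj := mul_right_injective₀ hirr.ne_zero
  have hsum := h.hilbertFn_add_finrank_map_pullback (fatIdeal 2 (h.curvePointsWithApex U)) (d + 3)
  have hres := hilbertFn_add_finrank_degreePart (fatIdeal 1 (h.curvePoints U)) d
  rw [h.map_pullback_degreePart_curvePointsWithApex hU hcard, finrank_boundedMultiples
      (mul_ne_zero (pow_ne_zero 2 h.left_ne_zero) (pow_ne_zero 2 nodal_ne_zero)),
    h.homogeneousSubmodule_inf_ker_pullback hirr,
    h.degreePart_curvePointsWithApex_inf_ker_pullback hirr hU,
    ← (Submodule.equivMapOfInjective _ hinj _).finrank_eq,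
    ← (Submodule.equivMapOfInjective _ hinj _).finrank_eq] at hsum
  lia

theorem hilbertFn_curvePointsWithApex_of_lt (hirr : Irreducible (cubicForm q c))
    (hU : ∀ u ∈ U, q.eval u ≠ 0) (hcard : 4 ≤ U.card) {d : ℕ} (hd : d < 3) :
    hilbertFn (fatIdeal 2 (h.curvePointsWithApex U)) d = 3 * d - 1 + 1 := by
  have hker : homogeneousSubmodule (Fin 3) k d ⊓ (pullback q c).toLinearMap.ker = ⊥ :=
    (Submodule.eq_bot_iff _).2 fun G hG => h.eq_zero_of_pullback_eq_zero hirr hd hG.1 hG.2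
  have hbot : degreePart (fatIdeal 2 (h.curvePointsWithApex U)) d = ⊥ := by
    refine (Submodule.eq_bot_iff _).2 fun G hG => ?_
    obtain ⟨hG, hmem⟩ := mem_degreePart.1 hG
    refine h.eq_zero_of_pullback_eq_zero hirr hd hG (Polynomial.eq_zero_of_dvd_of_natDegree_lt
      ((h.mem_fatIdeal_two_curvePointsWithApex_iff hG hU).1 hmem).2.1 ?_)
    have hdeg := mem_degreeLT_succ.1 (h.curveForms_le_degreeLT d (h.pullback_mem_curveForms hG))
    rw [Polynomial.natDegree_pow, natDegree_nodal]
    lia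
  have hsum := h.hilbertFn_add_finrank_map_pullback (fatIdeal 2 (h.curvePointsWithApex U)) d
  rwa [hker, hbot, Submodule.map_bot, bot_inf_eq, add_left_inj, finrank_bot, add_zero] at hsum

end IsNormalPair

/-! ### The difference functions -/

namespace IsNormalPair

open Lagrange

variable {k : Type*} [Field k] {q c : k[X]} (h : IsNormalPair q c) {U : Finset k}

theorem hilbertFn_curvePoints_of_ne (hU : ∀ u ∈ U, q.eval u ≠ 0) {d : ℕ} (hd : 3 * d ≠ U.card) :
    hilbertFn (fatIdeal 1 (h.curvePoints U)) d = min (3 * d - 1 + 1) U.card := by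
  rcases lt_or_gt_of_ne hd with hlt | hgt
  · rw [h.hilbertFn_curvePoints_of_lt hlt, min_eq_left (by lia)]
  · rw [h.hilbertFn_curvePoints_of_gt hU hgt, min_eq_right (by lia)]

theorem doubleDiff_eq (hirr : Irreducible (cubicForm q c)) (hU : ∀ u ∈ U, q.eval u ≠ 0)
    (hcard : 6 ≤ U.card) {T : ℕ → ℤ} (hlow : ∀ d ≤ 4, T d = d + 1)
    (hhigh : ∀ d, T (d + 5) = 3 + hilbertFn (fatIdeal 1 (h.curvePoints U)) (d + 2) -
      hilbertFn (fatIdeal 1 (h.curvePoints U)) (d + 1) -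
      (3 * (d + 4) - 2 * U.card : ℕ) + (3 * (d + 3) - 2 * U.card : ℕ)) :
    doubleDiff (h.curvePointsWithApex U) = T := by
  have hlt (d : ℕ) (hd : d < 3) := h.hilbertFn_curvePointsWithApex_of_lt hirr hU (by lia) hd
  have hge := h.hilbertFn_curvePointsWithApex_add_three hirr hU hcard
  have hone (d : ℕ) (hd : d ≤ 1) := h.hilbertFn_curvePoints_of_ne (d := d) hU (by lia)
  funext d
  match d with
  | 0 => rw [hlow 0 (by lia), doubleDiff, firstDiff, hlt 0 (by lia)]; rfl
  | 1 => rw [hlow 1 (by lia), doubleDiff, firstDiff, hlt 1 (by lia), hlt 0 (by lia)]; rfl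
  | 2 => rw [hlow 2 (by lia), doubleDiff, firstDiff, hlt 2 (by lia), hlt 1 (by lia)]; rfl
  | 3 =>
    have h₃ := hge 0
    rw [hone 0 (by lia)] at h₃
    rw [hlow 3 (by lia), doubleDiff, firstDiff, hlt 2 (by lia)]
    lia
  | 4 =>
    have h₃ := hge 0
    have h₄ := hge 1
    rw [hone 0 (by lia)] at h₃
    rw [hone 1 (by lia)] at h₄
    rw [hlow 4 (by lia), doubleDiff, firstDiff]
    lia
  | d + 5 =>
    have h₁ := hge (d + 1)
    have h₂ := hge (d + 2)
    rw [hhigh d, doubleDiff, firstDiff]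
    lia

theorem doubleDiff_eq_table0 (hirr : Irreducible (cubicForm q c)) (hU : ∀ u ∈ U, q.eval u ≠ 0)
    {t : ℕ} (ht : 3 ≤ t) (hcard : U.card + 1 = 3 * t) :
    doubleDiff (h.curvePointsWithApex U) = table0 t := by
  refine h.doubleDiff_eq hirr hU (by lia) (fun d hd => if_pos hd) fun d => ?_
  rw [h.hilbertFn_curvePoints_of_ne hU (by lia), h.hilbertFn_curvePoints_of_ne hU (by lia), table0]
  split_ifs <;> lia

theorem doubleDiff_eq_table2 (hirr : Irreducible (cubicForm q c)) (hU : ∀ u ∈ U, q.eval u ≠ 0)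
    {t : ℕ} (ht : 3 ≤ t) (hcard : U.card = 3 * t + 1) :
    doubleDiff (h.curvePointsWithApex U) = table2 t := by
  refine h.doubleDiff_eq hirr hU (by lia) (fun d hd => if_pos hd) fun d => ?_
  rw [h.hilbertFn_curvePoints_of_ne hU (by lia), h.hilbertFn_curvePoints_of_ne hU (by lia), table2]
  split_ifs <;> lia

theorem doubleDiff_eq_table1a (hirr : Irreducible (cubicForm q c)) (hU : ∀ u ∈ U, q.eval u ≠ 0)
    {t : ℕ} (ht : 3 ≤ t) (hcard : U.card = 3 * t) (hS : nodal U id ∉ curveForms q c t) :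
    doubleDiff (h.curvePointsWithApex U) = table1a t := by
  have hval (d : ℕ) : hilbertFn (fatIdeal 1 (h.curvePoints U)) d = min (3 * d - 1 + 1) (3 * t) := by
    rcases eq_or_ne d t with rfl | hd
    · rw [h.hilbertFn_curvePoints_of_notMem hcard.symm hS]
      lia
    · rw [h.hilbertFn_curvePoints_of_ne hU (by lia), hcard]
  refine h.doubleDiff_eq hirr hU (by lia) (fun d hd => if_pos hd) fun d => ?_
  rw [hval, hval, table1a, hcard]
  split_ifs <;> lia

theorem doubleDiff_eq_table1b (hirr : Irreducible (cubicForm q c)) (hU : ∀ u ∈ U, q.eval u ≠ 0)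
    {t : ℕ} (ht : 3 ≤ t) (hcard : U.card = 3 * t) (hS : nodal U id ∈ curveForms q c t) :
    doubleDiff (h.curvePointsWithApex U) = table1b t := by
  have hval (d : ℕ) : hilbertFn (fatIdeal 1 (h.curvePoints U)) d =
      if d = t then 3 * t - 1 else min (3 * d - 1 + 1) (3 * t) := by
    rcases eq_or_ne d t with rfl | hd
    · rw [if_pos rfl, h.hilbertFn_curvePoints_of_mem hcard.symm hS]
    · rw [if_neg hd, h.hilbertFn_curvePoints_of_ne hU (by lia), hcard]
  refine h.doubleDiff_eq hirr hU (by lia) (fun d hd => if_pos hd) fun d => ?_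
  rw [hval, hval, table1b, hcard]
  split_ifs <;> lia

include h in
theorem eq_apex_of_eval_cubicForm_eq_zero {v : Fin 3 → k} (hv : v ≠ 0)
    (hF : eval v (cubicForm q c) = 0) (hv₂ : v 2 = 0) : Projectivization.mk k v hv = apex := by
  have hvec : v = ![v 0, v 1, 0] := by
    ext i
    fin_cases i <;> simp [hv₂]
  have hv₁ : v 1 = 0 := by
    have hlead := Polynomial.leadingCoeff_ne_zero.2 h.right_ne_zero
    rw [Polynomial.leadingCoeff, h.natDegree_right] at hlead
    have hq₂ := Polynomial.coeff_eq_zero_of_natDegree_lt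
      (h.natDegree_left_le.trans_lt one_lt_two)
    rw [hvec, eval_cubicForm_infinity, hq₂, zero_mul, mul_zero, zero_add] at hF
    exact eq_zero_of_pow_eq_zero ((mul_eq_zero.1 hF).resolve_left hlead)
  refine (Projectivization.mk_eq_mk_iff' k _ _ _ _).2 ⟨v 0, ?_⟩
  rw [hvec, hv₁]
  simp

theorem exists_eq_curvePoint {p : Plane k} (hp : VanishesAt (cubicForm q c) p) (hne : p ≠ apex) :
    ∃ u, q.eval u ≠ 0 ∧ h.curvePoint u = p := by
  induction p using Projectivization.ind with
  | h v hv =>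
  rw [vanishesAt_mk (cubicForm_isHomogeneous q c)] at hp
  have hv₂ : v 2 ≠ 0 := fun hv₂ => hne (h.eq_apex_of_eval_cubicForm_eq_zero hv hp hv₂)
  have hvec : v = ![v 0, v 1 / v 2 * v 2, v 2] := by
    ext i
    fin_cases i <;> simp [hv₂]
  rw [hvec, eval_cubicForm (h.natDegree_left_le.trans one_le_two) h.natDegree_right.le] at hp
  have hcurve : v 0 * q.eval (v 1 / v 2) = -(v 2 * c.eval (v 1 / v 2)) := by
    refine mul_left_cancel₀ (pow_ne_zero 2 hv₂) ?_
    linear_combination hp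
  refine ⟨v 1 / v 2, fun hq => ?_, ?_⟩
  · rw [hq, mul_zero, zero_eq_neg, mul_eq_zero, or_iff_right hv₂] at hcurve
    obtain ⟨a, b, hab⟩ := h.isCoprime
    simpa [hq, hcurve] using congrArg (Polynomial.eval (v 1 / v 2)) hab
  · refine (Projectivization.mk_eq_mk_iff' k _ _ _ _).2 ⟨q.eval (v 1 / v 2) / v 2, ?_⟩
    ext i
    fin_cases i
    · simp only [Fin.zero_eta, Pi.smul_apply, smul_eq_mul, curveVec, Matrix.cons_val_zero]
      field_simp
      linear_combination hcurve
    · simp only [Fin.mk_one, Pi.smul_apply, smul_eq_mul, curveVec, Matrix.cons_val_one,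
        Matrix.cons_val_zero]
      field_simp
    · simp [curveVec, hv₂]

theorem vanishesAt_cubicForm_of_mem_curvePointsWithApex {p : Plane k}
    (hp : p ∈ h.curvePointsWithApex U) : VanishesAt (cubicForm q c) p := by
  classical
  have hF := cubicForm_isHomogeneous q c
  rcases Finset.mem_insert.1 hp with rfl | hp
  · rw [apex, vanishesAt_mk hF, eval_cubicForm_infinity, zero_pow two_ne_zero]
    simp
  · obtain ⟨u, -, rfl⟩ := Finset.mem_image.1 hp
    rw [curvePoint, vanishesAt_mk hF, ← eval_pullback,
      pullback_cubicForm (h.natDegree_left_le.trans one_le_two) h.natDegree_right.le,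
      Polynomial.eval_zero]

theorem exists_eq_curvePointsWithApex {X : Finset (Plane k)} (hP : apex ∈ X)
    (hX : ∀ Q ∈ X, VanishesAt (cubicForm q c) Q) :
    ∃ U : Finset k, (∀ u ∈ U, q.eval u ≠ 0) ∧ h.curvePointsWithApex U = X := by
  classical
  have hsub : (X.erase apex : Set (Plane k)) ⊆ h.curvePoint '' {u | q.eval u ≠ 0} := by
    intro p hp
    obtain ⟨hne, hmem⟩ := Finset.mem_erase.1 hp
    exact h.exists_eq_curvePoint (hX p hmem) hne
  obtain ⟨U, hU, hUX⟩ := Finset.subset_set_image_iff.1 hsub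
  exact ⟨U, hU, by rw [curvePointsWithApex, curvePoints, hUX, Finset.insert_erase hP]⟩

include h in
theorem hasTables (hirr : Irreducible (cubicForm q c)) {t : ℕ} (ht : 3 ≤ t)
    (ha : ∃ U : Finset k, (∀ u ∈ U, q.eval u ≠ 0) ∧ U.card = 3 * t ∧
      nodal U id ∉ curveForms q c t)
    (hb : ∃ U : Finset k, (∀ u ∈ U, q.eval u ≠ 0) ∧ U.card = 3 * t ∧
      nodal U id ∈ curveForms q c t) : HasTables (cubicForm q c) apex t := by
  classical
  refine ⟨fun X hX hXF => ?_, ?_, ?_⟩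
  · obtain ⟨U, hU, rfl⟩ := h.exists_eq_curvePointsWithApex hX hXF
    rw [h.card_curvePointsWithApex hU, Nat.add_left_inj, Nat.add_left_inj]
    refine ⟨h.doubleDiff_eq_table0 hirr hU ht, fun hcard => ?_, h.doubleDiff_eq_table2 hirr hU ht⟩
    by_cases hS : nodal U id ∈ curveForms q c t
    · exact Or.inr (h.doubleDiff_eq_table1b hirr hU ht hcard hS)
    · exact Or.inl (h.doubleDiff_eq_table1a hirr hU ht hcard hS)
  · obtain ⟨U, hU, hcard, hS⟩ := ha
    exact ⟨h.curvePointsWithApex U, Finset.mem_insert_self _ _,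
      fun Q => h.vanishesAt_cubicForm_of_mem_curvePointsWithApex,
      by rw [h.card_curvePointsWithApex hU, hcard], h.doubleDiff_eq_table1a hirr hU ht hcard hS⟩
  · obtain ⟨U, hU, hcard, hS⟩ := hb
    exact ⟨h.curvePointsWithApex U, Finset.mem_insert_self _ _,
      fun Q => h.vanishesAt_cubicForm_of_mem_curvePointsWithApex,
      by rw [h.card_curvePointsWithApex hU, hcard], h.doubleDiff_eq_table1b hirr hU ht hcard hS⟩

end IsNormalPair

/-! ### Both shapes occur -/

section Selection

variable {A : Type*} [CommGroup A] [Infinite A]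

theorem exists_finset_prod_ne {n : ℕ} (hn : n ≠ 0) (r : A) :
    ∃ S : Finset A, S.card = n ∧ ∏ a ∈ S, a ≠ r := by
  classical
  obtain ⟨m, rfl⟩ := Nat.exists_eq_succ_of_ne_zero hn
  obtain ⟨S, rfl⟩ := Infinite.exists_subset_card_eq A m
  obtain ⟨a, ha⟩ := Infinite.exists_notMem_finset (insert (r / ∏ a ∈ S, a) S)
  rw [Finset.mem_insert, not_or] at ha
  refine ⟨insert a S, Finset.card_insert_of_notMem ha.2, ?_⟩
  rw [Finset.prod_insert ha.2, ne_eq, ← eq_div_iff_mul_eq']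
  exact ha.1

theorem exists_finset_prod_eq (hsq : ∀ r : A, r ≠ 1 → {a : A | a * a = r}.Finite) {n : ℕ}
    (hn : 3 ≤ n) (r : A) : ∃ S : Finset A, S.card = n ∧ ∏ a ∈ S, a = r := by
  classical
  obtain ⟨m, rfl⟩ := Nat.exists_eq_add_of_le' (show 2 ≤ n by lia)
  obtain ⟨S, rfl, hSr⟩ := exists_finset_prod_ne (show m ≠ 0 by lia) r
  set s := r / ∏ a ∈ S, a with hs
  have hs₁ : s ≠ 1 := fun h => hSr (div_eq_one.1 h).symm
  obtain ⟨a, ha⟩ := Infinite.exists_notMem_finset (S ∪ S.image (s / ·) ∪ (hsq s hs₁).toFinset)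
  simp only [Finset.mem_union, Finset.mem_image, Set.Finite.mem_toFinset, Set.mem_ofPred_eq,
    not_or, not_exists, not_and] at ha
  obtain ⟨⟨haS, ha_image⟩, ha_sq⟩ := ha
  have hb : s / a ∉ S := fun hmem => ha_image _ hmem (div_div_cancel s a)
  have hab : a ∉ insert (s / a) S := by
    rw [Finset.mem_insert, not_or]
    exact ⟨fun h => ha_sq (eq_div_iff_mul_eq'.1 h), haS⟩
  refine ⟨insert a (insert (s / a) S), ?_, ?_⟩
  · rw [Finset.card_insert_of_notMem hab, Finset.card_insert_of_notMem hb]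
  · rw [Finset.prod_insert hab, Finset.prod_insert hb, ← mul_assoc, mul_div_cancel, hs,
      div_mul_cancel]

end Selection

section

variable {k : Type*} [Field k]

theorem finite_setOf_units_mul_self_eq (r : kˣ) : {a : kˣ | a * a = r}.Finite := by
  classical
  have hroots := (Polynomial.nthRoots 2 (r : k)).toFinset.finite_toSet
  refine (hroots.preimage Units.val_injective.injOn).subset fun a (ha : a * a = r) => ?_
  rw [Set.mem_preimage, Finset.mem_coe, Multiset.mem_toFinset,
    Polynomial.mem_nthRoots two_pos, pow_two, ← ha, Units.val_mul]

theorem finite_setOf_multiplicative_mul_self_eq {r : Multiplicative k} (hr : r ≠ 1) :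
    {a : Multiplicative k | a * a = r}.Finite := by
  refine Set.Subsingleton.finite fun a ha b hb => ?_
  have ha : a.toAdd + a.toAdd = r.toAdd := congrArg Multiplicative.toAdd ha
  have hb : b.toAdd + b.toAdd = r.toAdd := congrArg Multiplicative.toAdd hb
  have htwo : (2 : k) ≠ 0 := fun h => hr (toAdd_eq_zero.1 (by rw [← ha, ← two_mul, h, zero_mul]))
  refine Multiplicative.toAdd.injective (mul_left_cancel₀ htwo ?_)
  rw [two_mul, two_mul, ha, hb]

theorem exists_eq_C_mul_X_sub_C {q : k[X]} (hq : q.natDegree = 1) {z : k} (hz : q.IsRoot z) :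
    ∃ a ≠ 0, q = Polynomial.C a * (Polynomial.X - Polynomial.C z) := by
  obtain ⟨g, rfl⟩ := Polynomial.dvd_iff_isRoot.2 hz
  have hg : g ≠ 0 := by
    rintro rfl
    simp at hq
  rw [Polynomial.natDegree_mul (Polynomial.X_sub_C_ne_zero z) hg, Polynomial.natDegree_X_sub_C,
    Nat.add_eq_left] at hq
  rw [Polynomial.eq_C_of_natDegree_eq_zero hq] at hg ⊢
  exact ⟨_, Polynomial.C_ne_zero.1 hg, mul_comm _ _⟩

theorem infinite_units [Infinite k] : Infinite kˣ := by
  have hcompl : ({0}ᶜ : Set k).Infinite := (Set.finite_singleton 0).infinite_compl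
  have := hcompl.to_subtype
  exact unitsEquivNeZero.infinite_iff.2 this

end

/-- `φ` parametrizes smooth points of the cubic by a group `A` in such a way that `3 t` distinct
points are cut out by a form of degree `t` exactly when their product in `A` is `r`. For a nodal
cubic one can take `A = kˣ`, and for a cuspidal one the additive group of `k`. -/
structure IsSectionLaw {k A : Type*} [Field k] [CommGroup A] (q c : k[X]) (t : ℕ) (φ : A ↪ k)
    (r : A) : Prop where
  eval_ne_zero (a : A) : q.eval (φ a) ≠ 0
  nodal_mem_iff {S : Finset A} (hS : S.card = 3 * t) :
    Lagrange.nodal (S.map φ) id ∈ curveForms q c t ↔ ∏ a ∈ S, a = r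

namespace IsNormalPair

open Lagrange

variable {k : Type*} [Field k] {q c : k[X]} (h : IsNormalPair q c)

include h

theorem nodal_sub_mem_degreeLT {t : ℕ} {U : Finset k} (hcard : U.card = 3 * t) :
    nodal U id - ((-c) ^ t).leadingCoeff⁻¹ • (-c) ^ t ∈ Polynomial.degreeLT k (3 * t) := by
  have hlead := Polynomial.leadingCoeff_ne_zero.2 (h.neg_right_pow_ne_zero t)
  rw [Polynomial.mem_degreeLT, ← hcard, ← degree_nodal (v := id), Polynomial.smul_eq_C_mul]
  refine Polynomial.degree_sub_lt_left ?_ nodal_ne_zero ?_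
  · rw [degree_nodal, hcard, Polynomial.degree_C_mul (inv_ne_zero hlead),
      Polynomial.degree_eq_natDegree (h.neg_right_pow_ne_zero t), h.natDegree_neg_right_pow]
  · rw [Polynomial.leadingCoeff_mul, Polynomial.leadingCoeff_C, inv_mul_cancel₀ hlead,
      nodal_monic.leadingCoeff]

theorem nodal_mem_curveForms_iff {t : ℕ} {U : Finset k} (hcard : U.card = 3 * t) :
    nodal U id ∈ curveForms q c t ↔
      nodal U id - ((-c) ^ t).leadingCoeff⁻¹ • (-c) ^ t ∈ boundedMultiples q (3 * t - 1) := by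
  have hpow : ((-c) ^ t).leadingCoeff⁻¹ • (-c) ^ t ∈ curveForms q c t :=
    Submodule.smul_mem _ _ (Submodule.mem_sup_left (Submodule.mem_span_singleton_self _))
  rw [← h.curveForms_inf_degreeLT, Submodule.mem_inf,
    and_iff_left (h.nodal_sub_mem_degreeLT hcard), Submodule.sub_mem_iff_left _ hpow]

theorem nodal_mem_curveForms_iff_prod (hq : q.natDegree = 1) {z : k} (hz : q.IsRoot z) {t : ℕ}
    {U : Finset k} (hcard : U.card = 3 * t) : nodal U id ∈ curveForms q c t ↔
      ∏ u ∈ U, (z - u) = ((-c) ^ t).leadingCoeff⁻¹ * ((-c) ^ t).eval z := by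
  obtain ⟨a, ha, hqa⟩ := exists_eq_C_mul_X_sub_C hq hz
  have hdvd (f : k[X]) : q ∣ f ↔ f.eval z = 0 := by
    rw [hqa, (Polynomial.isUnit_C.2 ha.isUnit).mul_left_dvd, Polynomial.dvd_iff_isRoot,
      Polynomial.IsRoot.def]
  have hmem {f : k[X]} :=
    mem_boundedMultiples_sub_natDegree (x := f) h.left_ne_zero (n := 3 * t)
  rw [hq] at hmem
  rw [h.nodal_mem_curveForms_iff hcard, hmem, and_iff_left (h.nodal_sub_mem_degreeLT hcard),
    hdvd, Polynomial.eval_sub, eval_nodal, Polynomial.eval_smul, smul_eq_mul, sub_eq_zero]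
  rfl

theorem nodal_mem_curveForms_iff_sum (hq : q.natDegree = 0) {t : ℕ} (ht : t ≠ 0)
    {U : Finset k} (hcard : U.card = 3 * t) : nodal U id ∈ curveForms q c t ↔
      -∑ u ∈ U, u = ((-c) ^ t).leadingCoeff⁻¹ * ((-c) ^ t).coeff (3 * t - 1) := by
  have hunit : IsUnit q :=
    Polynomial.isUnit_iff_degree_eq_zero.2 (by
      rw [Polynomial.degree_eq_natDegree h.left_ne_zero, hq, Nat.cast_zero])
  have hcoeff : (nodal U id).coeff (3 * t - 1) = -∑ u ∈ U, u := by
    rw [← hcard]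
    exact Polynomial.prod_X_sub_C_coeff_card_pred U id (by lia)
  have hlt := h.nodal_sub_mem_degreeLT hcard
  rw [show 3 * t = 3 * t - 1 + 1 by lia] at hlt
  rw [h.nodal_mem_curveForms_iff hcard, ← Nat.sub_zero (3 * t - 1), ← hq,
    mem_boundedMultiples_sub_natDegree h.left_ne_zero, and_iff_right hunit.dvd,
    mem_degreeLT_iff_coeff_eq_zero hlt, Polynomial.coeff_sub, hcoeff, hq, Nat.sub_zero,
    Polynomial.coeff_smul, smul_eq_mul, sub_eq_zero]

theorem exists_isSectionLaw_units (hq : q.natDegree = 1) (t : ℕ) :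
    ∃ (φ : kˣ ↪ k) (r : kˣ), IsSectionLaw q c t φ r := by
  obtain ⟨z, hz⟩ := Polynomial.exists_root_of_degree_eq_one
    ((Polynomial.degree_eq_iff_natDegree_eq_of_pos one_pos).2 hq)
  obtain ⟨a, ha, hqa⟩ := exists_eq_C_mul_X_sub_C hq hz
  have hcz : ((-c) ^ t).eval z ≠ 0 := fun hcz => by
    obtain ⟨b, b', hb⟩ := h.isCoprime_neg_right_pow t
    simpa [hcz, hz.eq_zero] using congrArg (Polynomial.eval z) hb
  have hlead := Polynomial.leadingCoeff_ne_zero.2 (h.neg_right_pow_ne_zero t)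
  refine ⟨⟨fun v => z - v, sub_right_injective.comp Units.val_injective⟩,
    Units.mk0 _ (mul_ne_zero (inv_ne_zero hlead) hcz), fun v => ?_, fun {S} hS => ?_⟩
  · simp [hqa, ha]
  · rw [h.nodal_mem_curveForms_iff_prod hq hz (by rw [Finset.card_map, hS]), Finset.prod_map,
      Units.ext_iff]
    simp

theorem exists_isSectionLaw_multiplicative (hq : q.natDegree = 0) {t : ℕ} (ht : t ≠ 0) :
    ∃ (φ : Multiplicative k ↪ k) (r : Multiplicative k), IsSectionLaw q c t φ r := by
  refine ⟨⟨fun v => -v.toAdd, neg_injective.comp Multiplicative.toAdd.injective⟩,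
    .ofAdd (((-c) ^ t).leadingCoeff⁻¹ * ((-c) ^ t).coeff (3 * t - 1)),
    fun v hv => h.left_ne_zero ?_, fun {S} hS => ?_⟩
  · rw [Polynomial.eq_C_of_natDegree_eq_zero hq, Polynomial.eval_C] at hv
    rw [Polynomial.eq_C_of_natDegree_eq_zero hq, hv, Polynomial.C_0]
  · rw [h.nodal_mem_curveForms_iff_sum hq ht (by rw [Finset.card_map, hS]), Finset.sum_map,
      ← Multiplicative.toAdd.injective.eq_iff, toAdd_prod, toAdd_ofAdd]
    simp

theorem hasTables_of_isSectionLaw {A : Type*} [CommGroup A] [Infinite A]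
    (hsq : ∀ s : A, s ≠ 1 → {a : A | a * a = s}.Finite)
    (hirr : Irreducible (cubicForm q c)) {t : ℕ} (ht : 3 ≤ t) {φ : A ↪ k} {r : A}
    (hφ : IsSectionLaw q c t φ r) : HasTables (cubicForm q c) apex t := by
  have hU (S : Finset A) : ∀ u ∈ S.map φ, q.eval u ≠ 0 :=
    Finset.forall_mem_map.2 fun a _ => hφ.eval_ne_zero a
  obtain ⟨S, hS, hSr⟩ := exists_finset_prod_ne (n := 3 * t) (by lia) r
  obtain ⟨T, hT, hTr⟩ := exists_finset_prod_eq hsq (n := 3 * t) (by lia) r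
  exact h.hasTables hirr ht
    ⟨S.map φ, hU S, by rw [Finset.card_map, hS], mt (hφ.nodal_mem_iff hS).1 hSr⟩
    ⟨T.map φ, hU T, by rw [Finset.card_map, hT], (hφ.nodal_mem_iff hT).2 hTr⟩

theorem hasTables_cubicForm [Infinite k] (hirr : Irreducible (cubicForm q c)) {t : ℕ}
    (ht : 3 ≤ t) : HasTables (cubicForm q c) apex t := by
  have := infinite_units (k := k)
  rcases Nat.le_one_iff_eq_zero_or_eq_one.1 h.natDegree_left_le with hq | hq
  · obtain ⟨φ, r, hφ⟩ := h.exists_isSectionLaw_multiplicative hq (t := t) (by lia)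
    exact h.hasTables_of_isSectionLaw (fun _ => finite_setOf_multiplicative_mul_self_eq) hirr ht hφ
  · obtain ⟨φ, r, hφ⟩ := h.exists_isSectionLaw_units hq t
    exact h.hasTables_of_isSectionLaw (fun s _ => finite_setOf_units_mul_self_eq s) hirr ht hφ

end IsNormalPair

end FatPoints

theorem theorem3p5_general {k : Type*} [Field k] [IsAlgClosed k]
    (F : MvPolynomial (Fin 3) k) (hF : F.IsHomogeneous 3) (hirr : Irreducible F)
    (P : FatPoints.Plane k) (hP : FatPoints.IsSingularPoint F P)
    (t : ℕ) (ht : 3 ≤ t) : FatPoints.HasTables F P t := by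
  have : Infinite k := IsAlgClosed.instInfinite
  obtain ⟨e, q, c, rfl, hqc, he⟩ := FatPoints.exists_linSubst_eq_cubicForm hF hirr hP
  refine FatPoints.HasTables.of_linSubst e hF ?_
  rw [he]
  exact hqc.hasTables_cubicForm
    (he ▸ (MulEquiv.irreducible_iff (FatPoints.linSubst e)).2 hirr) ht

theorem theorem3p5 {k : Type*} [Field k] [IsAlgClosed k]
    (F : MvPolynomial (Fin 3) k) (hF : F.IsHomogeneous 3) (hirr : Irreducible F)
    (P : FatPoints.Plane k) (hP : FatPoints.IsSingularPoint F P)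
    (t : ℕ) (ht : 3 < t) :
    (∀ X : Finset (FatPoints.Plane k), P ∈ X → (∀ Q ∈ X, FatPoints.VanishesAt F Q) →
      (X.card = 3 * t → FatPoints.doubleDiff X = FatPoints.table0 t) ∧
      (X.card = 3 * t + 1 →
        FatPoints.doubleDiff X = FatPoints.table1a t ∨
        FatPoints.doubleDiff X = FatPoints.table1b t) ∧
      (X.card = 3 * t + 2 → FatPoints.doubleDiff X = FatPoints.table2 t)) ∧
    (∃ X : Finset (FatPoints.Plane k), P ∈ X ∧ (∀ Q ∈ X, FatPoints.VanishesAt F Q) ∧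
      X.card = 3 * t + 1 ∧ FatPoints.doubleDiff X = FatPoints.table1a t) ∧
    (∃ X : Finset (FatPoints.Plane k), P ∈ X ∧ (∀ Q ∈ X, FatPoints.VanishesAt F Q) ∧
      X.card = 3 * t + 1 ∧ FatPoints.doubleDiff X = FatPoints.table1b t) :=
  theorem3p5_general F hF hirr P hP t ht.le
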